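/- All logarithms are to base $2$. **Hard graphs.** Let $k,\ell$ be positive integers and $n=k\ell$. The random graph $G^{\mathrm{MIS}}_{\mathrm{hard}}(k,\ell)$ has $n$ vertices, split into levels $L_0,\dots,L_{\ell-1}$ of $k$ vertices each. Level $i$ is partitioned into clusters of size $k^{1/4^i}$ (rounded down if this is not an integer; the last cluster may then be smaller), and each cluster is a clique. In addition, independently for every $u\in L_i$ and $v\in L_j$ with $i<j$, the edge $uv$ is present with probability $q_i=k^{1/4^i-1}/\log^2 n$. **Framework ReduceMIS.** Put $G_0=G$. In iteration $i=0,1,2,\dots$ every vertex $v$ of the remaining graph $G_i$ is sampled independently with a probability $p_{i,v}\in[0,1]$ satisfying $p_{i,v}\le 1/\sqrt{\delta(G_i)}$, where $\delta(G_i)$ is the minimum degree of $G_i$ (no restriction if $\delta(G_i)=0$). Let $F_i$ be the set of sampled vertices, and let $S_i$ be the lexicographically first MIS of $G[F_i]$ with respect to an ordering of the vertices fixed in advance (possibly a different one for each iteration). Then $G_{i+1}$ is obtained from $G_i$ by deleting $\Gamma(S_i)$, i.e. $S_i$ and all neighbours of $S_i$. The algorithm has finished an MIS as soon as the remaining graph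 is empty. The probability $p_{i,v}$ may depend, in an arbitrary way, on $i$, on $v$, on the vertex set $V(G_i)$, on the neighbourhood $N_{G_i}(v)$ of $v$ in the remaining graph, and on the value $\sigma_i$ of a global parameter, which is an arbitrary function of $i$, of $V(G_i)$ and of the graph, with at most $N$ possible values. (This includes probabilities fixed in advance and capped by $1/\sqrt{\delta(G_i)}$, as well as $p_{i,v}=1/\sqrt{d(G_i)}$ with $d(G_i)$ the average degree, and $p_{i,v}=1/\sqrt{\deg_{G_i}(v)}$.) **Theorem.** There is a constant $c>0$ such that for every $C\in\mathbb N$ there is $k_0$ such that for all $k\ge k_0$ the following holds, with $\ell=\lfloor \log\log k/20\rfloor$ and $n=k\ell$. Let $G$ be drawn from $G^{\mathrm{MIS}}_{\mathrm{hard}}(k,\ell)$, and run on $G$ any algorithm of the framework ReduceMIS whose global parameters take at most $N\le 2^{(\log n)^C}$ values. Then, over the randomness of the graph and of the algorithm: 1. The algorithm needs at least $c\log\log n$ iterations to finish an MIS, with probability at least $1-2^{-2^{\sqrt{\log n}}}$; that is, for every integer $0\le t<c\log\log n$, with at least this probability $G_t$ is not empty. 2. For all integers $r,j$ with $0\le r\le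 \ell/2$ and $r\le j<\ell$, the graph $G_r$ contains at least $k\,(1-10\,\ell r/\log^2 n)$ vertices of $L_j$, with probability at least $1-2^{-2^{\sqrt{\log n}}}$. -/

import Mathlib

open Real

noncomputable section

/-! ### Independent sampling -/

/-- The random subset of `α` that contains each `a` independently with probability `p a`. -/
def randomSubset {α : Type*} [Fintype α] [DecidableEq α] (p : α → unitInterval) :
    PMF (Finset α) :=
  PMF.ofFintype
    (fun F => ∏ a, if a ∈ F then ENNReal.ofReal (p a : ℝ) else ENNReal.ofReal (1 - (p a : ℝ)))
    (by
      have h : ∏ a : α, (ENNReal.ofReal (p a : ℝ) + ENNReal.ofReal (1 - (p a : ℝ))) = 1 := by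
        refine Finset.prod_eq_one fun a _ => ?_
        rw [← ENNReal.ofReal_add (p a).2.1 (sub_nonneg.2 (p a).2.2)]
        simp
      rw [Finset.prod_add, Finset.powerset_univ] at h
      rw [← h]
      refine Finset.sum_congr rfl fun F _ => ?_
      rw [Finset.prod_ite]
      congr 2 <;> ext a <;> simp)

/-! ### The hard graph distribution -/

/-- The `k * ℓ` vertices: a vertex is a pair (level, index inside the level). -/
abbrev HardVertex (k ℓ : ℕ) : Type := Fin ℓ × Fin k

/-- The size `k ^ (1 / 4 ^ i)` of the clusters of level `i` (rounded down if not an integer). -/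
def clusterSize (k i : ℕ) : ℕ := ⌊(k : ℝ) ^ ((1 : ℝ) / 4 ^ i)⌋₊

/-- `u` and `v` lie in the same cluster: each level is cut into consecutive blocks of
`clusterSize k i` vertices (the last block may be smaller when the size does not divide `k`). -/
def SameCluster {k ℓ : ℕ} (u v : HardVertex k ℓ) : Prop :=
  u.1 = v.1 ∧ (u.2 : ℕ) / clusterSize k u.1 = (v.2 : ℕ) / clusterSize k v.1

/-- `q_i = k ^ (1 / 4 ^ i - 1) / log ^ 2 n`, where `n = k * ℓ`. -/
def crossProb (k ℓ i : ℕ) : ℝ :=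
  (k : ℝ) ^ ((1 : ℝ) / 4 ^ i - 1) / logb 2 ((k : ℝ) * ℓ) ^ 2

theorem crossProb_mem (k ℓ i : ℕ) : crossProb k ℓ i ∈ unitInterval := by
  refine ⟨by unfold crossProb; positivity, ?_⟩
  unfold crossProb
  rcases Nat.lt_or_ge (k * ℓ) 2 with h | h
  · have : logb 2 ((k : ℝ) * ℓ) = 0 := by
      rw [← Nat.cast_mul]
      interval_cases k * ℓ <;> simp
    simp [this]
  · have hk : 1 ≤ k := by
      rcases Nat.eq_zero_or_pos k with rfl | hk
      · simp at h
      · exact hk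
    have hn : (2 : ℝ) ≤ (k : ℝ) * ℓ := by exact_mod_cast h
    have hlog : 1 ≤ logb 2 ((k : ℝ) * ℓ) := by
      rw [Real.le_logb_iff_rpow_le (by norm_num) (by linarith)]
      simpa using hn
    have hnum : (k : ℝ) ^ ((1 : ℝ) / 4 ^ i - 1) ≤ 1 := by
      refine Real.rpow_le_one_of_one_le_of_nonpos (by exact_mod_cast hk) ?_
      have : (1 : ℝ) / 4 ^ i ≤ 1 := by
        rw [div_le_one (by positivity)]
        exact one_le_pow₀ (by norm_num)
      linarith
    rw [div_le_one (by positivity)]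
    exact hnum.trans (one_le_pow₀ hlog)

/-- The probability with which a pair of vertices is chosen as a random edge; a pair is listed
with its lower level first, so that every pair in different levels is drawn exactly once. -/
def pairProb (k ℓ : ℕ) (e : HardVertex k ℓ × HardVertex k ℓ) : unitInterval :=
  if e.1.1 < e.2.1 then ⟨crossProb k ℓ e.1.1, crossProb_mem k ℓ e.1.1⟩ else 0

/-- Every cluster is a clique, and the pairs in `R` are added as edges. -/
def layeredGraph (k ℓ : ℕ) (R : Finset (HardVertex k ℓ × HardVertex k ℓ)) :
    SimpleGraph (HardVertex k ℓ) where
  Adj u v := u ≠ v ∧ (SameCluster u v ∨ (u, v) ∈ R ∨ (v, u) ∈ R)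
  symm := ⟨fun u v h => ⟨h.1.symm, by
    rcases h.2 with h | h | h
    · exact Or.inl ⟨h.1.symm, h.2.symm⟩
    · exact Or.inr (Or.inr h)
    · exact Or.inr (Or.inl h)⟩⟩
  loopless := ⟨fun _ h => h.1 rfl⟩

/-- The hard graph distribution for MIS with parameters `k` and `ℓ`. -/
def hardMIS (k ℓ : ℕ) : PMF (SimpleGraph (HardVertex k ℓ)) :=
  (randomSubset (pairProb k ℓ)).map (layeredGraph k ℓ)

/-! ### The iterative sampling framework -/

section Framework

variable {V : Type*} [Fintype V] [DecidableEq V]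

open Classical in
/-- The neighbours of `v` in the remaining graph `G[A]`. -/
def remNbrs (G : SimpleGraph V) (A : Finset V) (v : V) : Finset V :=
  A.filter fun w => G.Adj v w

open Classical in
/-- The minimum degree of the remaining graph `G[A]`. -/
def remMinDegree (G : SimpleGraph V) (A : Finset V) : ℕ :=
  (G.induce (A : Set V)).minDegree

open Classical in
/-- The lexicographically first MIS of `G[F]` with respect to the ordering
`ord 0, ord 1, …` of the vertices. -/
def lfmis (G : SimpleGraph V) (ord : Fin (Fintype.card V) ≃ V) (F : Finset V) : Finset V :=
  (List.ofFn ord).foldl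
    (fun S v => if v ∈ F ∧ ∀ s ∈ S, ¬ G.Adj s v then insert v S else S) ∅

open Classical in
/-- `Γ(S)`: the vertices that lie in `S` or have a neighbour in `S`. -/
def coveredBy (G : SimpleGraph V) (S : Finset V) : Finset V :=
  Finset.univ.filter fun v => v ∈ S ∨ ∃ s ∈ S, G.Adj s v

/-- An algorithm of the framework on the vertex set `V`. In iteration `i`, with active set `A` and
remaining graph `G[A]`, vertex `v ∈ A` is sampled with probability
`p_{i,v} = prob i A (stat i A G) v (remNbrs G A v)`: it is determined by the iteration, the active
set, the vertex, its own neighbourhood in the remaining graph, and a global parameter of the graph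
with at most `N` possible values (such as average, minimum or maximum degree). -/
structure ReduceMIS (V : Type*) [Fintype V] [DecidableEq V] (N : ℕ) where
  /-- the vertex ordering used for the lexicographically first MIS of iteration `i` -/
  order : ℕ → Fin (Fintype.card V) ≃ V
  /-- the global parameter -/
  stat : ℕ → Finset V → SimpleGraph V → Fin N
  /-- the sampling rule -/
  prob : ℕ → Finset V → Fin N → V → Finset V → unitInterval
  /-- `p_{i,v} ≤ 1 / √δ(G[A])`; there is no restriction if the minimum degree is zero. -/
  prob_le : ∀ (i : ℕ) (G : SimpleGraph V) (A : Finset V), ∀ v ∈ A,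
    (prob i A (stat i A G) v (remNbrs G A v) : ℝ) * √(remMinDegree G A : ℝ) ≤ 1

namespace ReduceMIS

variable {N : ℕ}

/-- The sampling probabilities `p_{i,v}` when `A` is active; inactive vertices are not sampled. -/
def sampleProb (alg : ReduceMIS V N) (i : ℕ) (G : SimpleGraph V) (A : Finset V) (v : V) :
    unitInterval :=
  if v ∈ A then alg.prob i A (alg.stat i A G) v (remNbrs G A v) else 0

/-- Iteration `i`: sample `F ⊆ A`, compute the lexicographically first MIS `S` of `G[F]`, and
remove `Γ(S)` from the active set `A`. -/
def step (alg : ReduceMIS V N) (i : ℕ) (G : SimpleGraph V) (A : Finset V) : PMF (Finset V) :=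
  (randomSubset (alg.sampleProb i G A)).map fun F => A \ coveredBy G (lfmis G (alg.order i) F)

/-- The law of the vertex set of `G_t`, the graph that remains after the `t` iterations
`0, …, t - 1` on the input graph `G`. The algorithm has finished an MIS within `t` iterations
exactly when this set is empty. -/
def active (alg : ReduceMIS V N) (G : SimpleGraph V) : ℕ → PMF (Finset V)
  | 0 => PMF.pure Finset.univ
  | t + 1 => (alg.active G t).bind (alg.step t G)

end ReduceMIS

end Framework

/-- The law of the vertex set of `G_t` when the input graph is drawn from the hard distribution
and the algorithm uses fresh independent randomness. -/
def hardActive {k ℓ N : ℕ} (alg : ReduceMIS (HardVertex k ℓ) N) (t : ℕ) :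
    PMF (Finset (HardVertex k ℓ)) :=
  (hardMIS k ℓ).bind fun G => alg.active G t

end

/-! Write s_i for k^(1/4^i) and L for log n. Two facts feed each other: after t ≤ ℓ/2 iterations
every level from t on is almost intact, and every surviving vertex has at least s_t/(16 L²)
surviving neighbours. The second caps the sampling probabilities of iteration t at 4L/√s_t =
4L/s_{t+1}².

Intact levels: let j > i. In a level a ≤ i the independent set of iteration i has at most one vertex
per cluster, about k/s_a in all, and each covers at most 2 s_a/L² vertices of level j. In a level a
> i only about k L/s_{i+1}² vertices are sampled, each covering at most 2 s_{i+1} vertices of level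
j. So an iteration costs level j at most 6 ℓ k/L² vertices (`card_newly_covered_le`,
`le_card_levelPart_alive`).

Large degrees: the obstacle is that the surviving set depends on the random edges. Fix the sampled
sets h and let only the edges vary. Rewiring pairs of survivors leaves the run unchanged
(`alive_congr_graph`); it changes only the probability of h. A survivor was never sampled, so its
contribution to that probability is a product of terms 1 - p, between 1/2 and 1 under the cap, and
it depends only on the survivor's own neighbourhood. Hence the pairs from a survivor v to the
survivors of another level remain independent up to bounded reweighting, and a Chernoff bound still
applies (`sum_powerset_lower_tail`, `sum_few_survivors_le`).

A global parameter would destroy this locality, so its sequence of values is fixed in advance and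
paid for by a union bound; the factor N^ℓ is negligible against exp(-2^(2√(log k))). The circularity
between cap and degrees is broken by truncating the rule at the cap: the truncated rule agrees with
the algorithm until the first iteration with a small degree (`eventProb_alg_le`,
`eventProb_alg_exists_not_degreesLarge_le`). -/

/-! ### Product measures on subsets and a Chernoff upper tail. -/

section Weights

variable {α : Type*} [Fintype α] [DecidableEq α]

/-- The probability of `F` when each `a` is chosen independently with probability `p a`. -/
noncomputable def subsetWeight (p : α → ℝ) (F : Finset α) : ℝ :=
  ∏ a, if a ∈ F then p a else 1 - p a

theorem subsetWeight_nonneg {p : α → ℝ} (h0 : ∀ a, 0 ≤ p a) (h1 : ∀ a, p a ≤ 1)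
    (F : Finset α) : 0 ≤ subsetWeight p F :=
  Finset.prod_nonneg fun a _ => by split_ifs <;> linarith [h0 a, h1 a]

theorem sum_prod_ite (a b : α → ℝ) :
    ∑ F : Finset α, ∏ x, (if x ∈ F then a x else b x) = ∏ x, (a x + b x) := by
  rw [Finset.prod_add, Finset.powerset_univ]
  refine Finset.sum_congr rfl fun F _ => ?_
  rw [Finset.prod_ite]
  congr 2 <;> ext a <;> simp

theorem sum_subsetWeight (p : α → ℝ) : ∑ F, subsetWeight p F = 1 := by
  unfold subsetWeight
  rw [sum_prod_ite]
  simp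

theorem randomSubset_apply_toReal (p : α → unitInterval) (F : Finset α) :
    (randomSubset p F).toReal = subsetWeight (fun a => (p a : ℝ)) F := by
  unfold randomSubset subsetWeight
  rw [PMF.ofFintype_apply, ENNReal.toReal_prod]
  refine Finset.prod_congr rfl fun a _ => ?_
  split_ifs
  · exact ENNReal.toReal_ofReal (p a).2.1
  · exact ENNReal.toReal_ofReal (sub_nonneg.2 (p a).2.2)

/-- The numerical core of the upper tail: 2 log 2 exceeds 5/4, so Markov's inequality at base 2 and
threshold twice the mean gains exp(-x/4). -/
theorem exp_le_two_rpow_mul_exp (x : ℝ) (hx : 0 ≤ x) :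
    exp x ≤ (2 : ℝ) ^ (2 * x) * exp (-(x / 4)) := by
  rw [rpow_def_of_pos (by norm_num), ← exp_add, exp_le_exp]
  nlinarith [Real.log_two_gt_d9]

/-- Upper tail bound for the number of chosen elements of `T`. -/
theorem sum_subsetWeight_upper_tail {p : α → ℝ} (h0 : ∀ a, 0 ≤ p a) (h1 : ∀ a, p a ≤ 1)
    (T : Finset α) {c : ℝ} (hc : 0 ≤ c) (hp : ∀ a ∈ T, p a ≤ c) :
    ∑ F, subsetWeight p F * (if ((F ∩ T).card : ℝ) ≤ 2 * (T.card * c) then 0 else 1) ≤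
      exp (-(T.card * c / 4)) := by
  set x : ℝ := T.card * c with hx
  have hx0 : 0 ≤ x := by positivity
  -- Markov's inequality for 2^|F ∩ T|; the factor 2 per chosen element of T is absorbed into the
  -- product weight.
  have hpt : ∀ F, subsetWeight p F * (if ((F ∩ T).card : ℝ) ≤ 2 * x then 0 else 1) ≤
      (2 : ℝ) ^ (-(2 * x)) *
        ∏ a, (if a ∈ F then (if a ∈ T then 2 * p a else p a) else 1 - p a) := by
    intro F
    have hprod : ∏ a, (if a ∈ F then (if a ∈ T then 2 * p a else p a) else 1 - p a) =
        2 ^ (F ∩ T).card * subsetWeight p F := by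
      have h2 : (2 : ℝ) ^ (F ∩ T).card = ∏ a, if a ∈ F ∩ T then 2 else 1 := by
        rw [Finset.prod_ite]
        simp only [Finset.prod_const, one_pow, mul_one]
        congr 2
        ext
        simp
      rw [h2, subsetWeight, ← Finset.prod_mul_distrib]
      refine Finset.prod_congr rfl fun a _ => ?_
      by_cases hF : a ∈ F <;> by_cases hT : a ∈ T <;> simp [hF, hT]
    rw [hprod]
    have hw := subsetWeight_nonneg h0 h1 F
    split_ifs with h
    · rw [mul_zero]; positivity
    · rw [mul_one, ← mul_assoc]
      refine le_mul_of_one_le_left hw ?_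
      rw [← rpow_natCast, ← rpow_add (by norm_num)]
      exact one_le_rpow (by norm_num) (by linarith)
  refine (Finset.sum_le_sum fun F _ => hpt F).trans ?_
  rw [← Finset.mul_sum, sum_prod_ite]
  -- The mean of 2^|F ∩ T| is the product of the factors 1 + p a over T, each at most exp c.
  have hle : ∏ a, ((if a ∈ T then 2 * p a else p a) + (1 - p a)) ≤ exp x := by
    have : ∏ a, ((if a ∈ T then 2 * p a else p a) + (1 - p a)) ≤
        ∏ a, (if a ∈ T then exp c else 1) := by
      refine Finset.prod_le_prod (fun a _ => ?_) (fun a _ => ?_)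
      · split_ifs <;> linarith [h0 a, h1 a]
      · split_ifs with h
        · linarith [hp a h, add_one_le_exp c]
        · linarith
    refine this.trans (le_of_eq ?_)
    rw [Finset.prod_ite]
    simp [hx, exp_nat_mul]
  refine (mul_le_mul_of_nonneg_left (hle.trans (exp_le_two_rpow_mul_exp x hx0))
    (by positivity)).trans (le_of_eq ?_)
  rw [← mul_assoc, ← rpow_add (by norm_num)]
  simp

end Weights

/-! ### Expectations under finite distributions. -/

section Expectation

variable {α β : Type*} [Fintype α] [Fintype β]

/-- The expectation of `f` under a distribution on a finite type. -/
noncomputable def PMF.mean (μ : PMF α) (f : α → ℝ) : ℝ := ∑ a, (μ a).toReal * f a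

theorem PMF.mean_pure (a : α) (f : α → ℝ) : (PMF.pure a).mean f = f a := by
  classical
  unfold PMF.mean
  rw [Finset.sum_eq_single a] <;> simp +contextual [PMF.pure_apply]

theorem PMF.mean_bind (μ : PMF α) (g : α → PMF β) (f : β → ℝ) :
    (μ.bind g).mean f = μ.mean fun a => (g a).mean f := by
  have h : ∀ b, ((μ.bind g) b).toReal = ∑ a, (μ a).toReal * (g a b).toReal := by
    intro b
    rw [PMF.bind_apply, tsum_fintype, ENNReal.toReal_sum]
    · simp [ENNReal.toReal_mul]
    · exact fun a _ => ENNReal.mul_ne_top (μ.apply_ne_top a) ((g a).apply_ne_top b)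
  simp only [PMF.mean, h, Finset.sum_mul, Finset.mul_sum]
  rw [Finset.sum_comm]
  simp only [mul_assoc]

theorem PMF.mean_map (μ : PMF α) (g : α → β) (f : β → ℝ) :
    (μ.map g).mean f = μ.mean fun a => f (g a) := by
  rw [← PMF.bind_pure_comp, PMF.mean_bind]
  simp [PMF.mean_pure]

open Classical in
theorem PMF.toReal_toOuterMeasure (μ : PMF α) (s : Set α) :
    (μ.toOuterMeasure s).toReal = μ.mean fun a => if a ∈ s then 1 else 0 := by
  rw [PMF.toOuterMeasure_apply, tsum_fintype, ENNReal.toReal_sum]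
  · refine Finset.sum_congr rfl fun a _ => ?_
    by_cases h : a ∈ s <;> simp [h]
  · intro a _
    by_cases h : a ∈ s <;> simp [h, μ.apply_ne_top a]

end Expectation

/-! ### Runs as sums over histories of sampled sets. -/

section Paths

variable {V : Type*} [Fintype V]

/-- The sum of `Φ` over all sequences of subsets of `V` supported on the first `t` indices. -/
noncomputable def pathSum : ℕ → ((ℕ → Finset V) → ℝ) → ℝ
  -- Indices from t on carry the default ∅; a run of t iterations never reads them.
  | 0, Φ => Φ fun _ => ∅
  | t + 1, Φ => pathSum t fun h => ∑ S : Finset V, Φ (Function.update h t S)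

theorem pathSum_mono (t : ℕ) {Φ Ψ : (ℕ → Finset V) → ℝ} (h : ∀ x, Φ x ≤ Ψ x) :
    pathSum t Φ ≤ pathSum t Ψ := by
  induction t generalizing Φ Ψ with
  | zero => exact h _
  | succ t ih => exact ih fun x => Finset.sum_le_sum fun S _ => h _

theorem pathSum_mul_left (t : ℕ) (c : ℝ) (Φ : (ℕ → Finset V) → ℝ) :
    pathSum t (fun x => c * Φ x) = c * pathSum t Φ := by
  induction t generalizing Φ with
  | zero => rfl
  | succ t ih => simp only [pathSum, ← Finset.mul_sum, ih]

theorem pathSum_sum {ι : Type*} (s : Finset ι) (t : ℕ) (Φ : ι → (ℕ → Finset V) → ℝ) :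
    pathSum t (fun x => ∑ i ∈ s, Φ i x) = ∑ i ∈ s, pathSum t (Φ i) := by
  induction t generalizing Φ with
  | zero => rfl
  | succ t ih =>
    simp only [pathSum]
    rw [← ih]
    congr 1
    funext h
    exact Finset.sum_comm

theorem pathSum_add (t : ℕ) (Φ Ψ : (ℕ → Finset V) → ℝ) :
    pathSum t (fun x => Φ x + Ψ x) = pathSum t Φ + pathSum t Ψ := by
  have := pathSum_sum (Finset.univ : Finset Bool) t (fun b => cond b Φ Ψ)
  simpa using this

variable [DecidableEq V]

/-- The vertex set that is active after `t` iterations with the sampled sets `h 0, h 1, …`. -/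
noncomputable def alive (G : SimpleGraph V) (ord : ℕ → Fin (Fintype.card V) ≃ V) (h : ℕ → Finset V) :
    ℕ → Finset V
  | 0 => Finset.univ
  | t + 1 => alive G ord h t \ coveredBy G (lfmis G (ord t) (h t))

theorem alive_congr_history {G : SimpleGraph V} {ord : ℕ → Fin (Fintype.card V) ≃ V}
    {h h' : ℕ → Finset V} {t : ℕ} (hh : ∀ i < t, h i = h' i) :
    alive G ord h t = alive G ord h' t := by
  induction t with
  | zero => rfl
  | succ t ih => rw [alive, alive, ih fun i hi => hh i (by omega), hh t (by omega)]

theorem alive_update (G : SimpleGraph V) (ord : ℕ → Fin (Fintype.card V) ≃ V)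
    (h : ℕ → Finset V) (S : Finset V) {i t : ℕ} (hi : i ≤ t) :
    alive G ord (Function.update h t S) i = alive G ord h i :=
  alive_congr_history fun j hj => by rw [Function.update_of_ne (by omega)]

theorem alive_antitone (G : SimpleGraph V) (ord : ℕ → Fin (Fintype.card V) ≃ V)
    (h : ℕ → Finset V) : Antitone (alive G ord h) :=
  antitone_nat_of_succ_le fun _ => Finset.sdiff_subset

/-- The probability that the first `t` sampled sets are `h 0, …, h (t - 1)`, when vertex `v` is
sampled with probability `P i A v` in iteration `i` with active set `A`. -/
noncomputable def sampleWeight (G : SimpleGraph V) (ord : ℕ → Fin (Fintype.card V) ≃ V)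
    (P : ℕ → Finset V → V → ℝ) (h : ℕ → Finset V) (t : ℕ) : ℝ :=
  ∏ i ∈ Finset.range t, subsetWeight (P i (alive G ord h i)) (h i)

theorem sampleWeight_nonneg {G : SimpleGraph V} {ord : ℕ → Fin (Fintype.card V) ≃ V}
    {P : ℕ → Finset V → V → ℝ} (h0 : ∀ i A v, 0 ≤ P i A v) (h1 : ∀ i A v, P i A v ≤ 1)
    (h : ℕ → Finset V) (t : ℕ) : 0 ≤ sampleWeight G ord P h t :=
  Finset.prod_nonneg fun _ _ => subsetWeight_nonneg (h0 _ _) (h1 _ _) _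

theorem sampleWeight_update_succ (G : SimpleGraph V) (ord : ℕ → Fin (Fintype.card V) ≃ V)
    (P : ℕ → Finset V → V → ℝ) (h : ℕ → Finset V) (t : ℕ) (S : Finset V) :
    sampleWeight G ord P (Function.update h t S) (t + 1) =
      sampleWeight G ord P h t * subsetWeight (P t (alive G ord h t)) S := by
  unfold sampleWeight
  rw [Finset.prod_range_succ, alive_update G ord h S le_rfl, Function.update_self]
  congr 1
  refine Finset.prod_congr rfl fun i hi => ?_
  have hi := Finset.mem_range.1 hi
  rw [alive_update G ord h S hi.le, Function.update_of_ne (by omega)]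

theorem pathSum_sampleWeight_succ (G : SimpleGraph V) (ord : ℕ → Fin (Fintype.card V) ≃ V)
    (P : ℕ → Finset V → V → ℝ) (t : ℕ) (Φ : (ℕ → Finset V) → ℝ) :
    pathSum (t + 1) (fun h => sampleWeight G ord P h (t + 1) * Φ h) =
      pathSum t fun h => sampleWeight G ord P h t *
        ∑ S, subsetWeight (P t (alive G ord h t)) S * Φ (Function.update h t S) := by
  simp only [pathSum, sampleWeight_update_succ, Finset.mul_sum, mul_assoc]

/-- An event blind to the last sample can be evaluated one iteration earlier, since that sample's
weights sum to 1. -/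
theorem pathSum_sampleWeight_succ_of_update (G : SimpleGraph V)
    (ord : ℕ → Fin (Fintype.card V) ≃ V) (P : ℕ → Finset V → V → ℝ) (t : ℕ)
    (Φ : (ℕ → Finset V) → ℝ) (hΦ : ∀ h S, Φ (Function.update h t S) = Φ h) :
    pathSum (t + 1) (fun h => sampleWeight G ord P h (t + 1) * Φ h) =
      pathSum t fun h => sampleWeight G ord P h t * Φ h := by
  simp only [pathSum_sampleWeight_succ, hΦ, ← Finset.sum_mul, sum_subsetWeight, one_mul]

theorem pathSum_sampleWeight (G : SimpleGraph V) (ord : ℕ → Fin (Fintype.card V) ≃ V)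
    (P : ℕ → Finset V → V → ℝ) (t : ℕ) :
    pathSum t (fun h => sampleWeight G ord P h t) = 1 := by
  induction t with
  | zero => simp [pathSum, sampleWeight]
  | succ t ih =>
    have := pathSum_sampleWeight_succ_of_update G ord P t (fun _ => 1) fun _ _ => rfl
    simp only [mul_one] at this
    rw [this, ih]

/-- Unfolds the Markov chain of active sets into a sum over sampled sets. History and graph become
separate summation variables, so that later the history can be held fixed while the edges vary. -/
theorem ReduceMIS.mean_active {N : ℕ} (alg : ReduceMIS V N) (G : SimpleGraph V) (t : ℕ)
    (f : Finset V → ℝ) :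
    (alg.active G t).mean f = pathSum t fun h =>
      sampleWeight G alg.order (fun i A v => alg.sampleProb i G A v) h t *
        f (alive G alg.order h t) := by
  induction t generalizing f with
  | zero => simp [ReduceMIS.active, PMF.mean_pure, pathSum, sampleWeight, alive]
  | succ t ih =>
    rw [ReduceMIS.active, PMF.mean_bind, ih, pathSum_sampleWeight_succ]
    congr 1
    funext h
    congr 1
    rw [ReduceMIS.step, PMF.mean_map]
    unfold PMF.mean
    refine Finset.sum_congr rfl fun S _ => ?_
    rw [randomSubset_apply_toReal, alive, alive_update _ _ _ _ le_rfl, Function.update_self]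

end Paths

theorem mean_hardActive {k ℓ N : ℕ} (alg : ReduceMIS (HardVertex k ℓ) N) (t : ℕ)
    (f : Finset (HardVertex k ℓ) → ℝ) :
    (hardActive alg t).mean f = ∑ R, subsetWeight (fun e => (pairProb k ℓ e : ℝ)) R *
      pathSum t fun h => sampleWeight (layeredGraph k ℓ R) alg.order
        (fun i A v => alg.sampleProb i (layeredGraph k ℓ R) A v) h t *
        f (alive (layeredGraph k ℓ R) alg.order h t) := by
  rw [hardActive, hardMIS, PMF.bind_map, PMF.mean_bind]
  unfold PMF.mean
  refine Finset.sum_congr rfl fun R _ => ?_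
  rw [randomSubset_apply_toReal]
  congr 1
  exact alg.mean_active _ t f

theorem mem_remNbrs {V : Type*} {G : SimpleGraph V} {A : Finset V} {v w : V} :
    w ∈ remNbrs G A v ↔ w ∈ A ∧ G.Adj v w := by
  simp [remNbrs]

theorem remNbrs_congr {V : Type*} {G G' : SimpleGraph V} {A : Finset V} {v : V}
    (hG : ∀ w ∈ A, (G.Adj v w ↔ G'.Adj v w)) : remNbrs G A v = remNbrs G' A v := by
  ext w
  simp only [mem_remNbrs]
  exact and_congr_right fun hw => hG w hw

/-- Nonemptiness matters: the minimum degree of the empty graph is 0 by convention. -/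
theorem le_remMinDegree {V : Type*} [Fintype V] {G : SimpleGraph V} {A : Finset V} (hA : A.Nonempty) {d : ℕ}
    (hd : ∀ v ∈ A, d ≤ (remNbrs G A v).card) : d ≤ remMinDegree G A := by
  classical
  unfold remMinDegree
  have : Nonempty (A : Set V) := hA.to_subtype
  refine SimpleGraph.le_minDegree_of_forall_le_degree _ _ fun v => ?_
  refine (hd v v.2).trans (le_of_eq ?_)
  rw [← SimpleGraph.card_neighborFinset_eq_degree,
    ← Finset.card_map (Function.Embedding.subtype (· ∈ (A : Set V)))]
  congr 1
  ext w
  simp [mem_remNbrs, and_comm]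

/-! ### The greedy independent set, and what a run can see of the graph. -/

section Lfmis

variable {V : Type*} [Fintype V] [DecidableEq V]

open Classical in
/-- One greedy pass over the list `l`, starting from the set `S`. -/
noncomputable def greedyPass (G : SimpleGraph V) (F : Finset V) (l : List V) (S : Finset V) :
    Finset V :=
  l.foldl (fun S v => if v ∈ F ∧ ∀ s ∈ S, ¬ G.Adj s v then insert v S else S) S

open Classical in
theorem greedyPass_cons (G : SimpleGraph V) (F : Finset V) (v : V) (l : List V) (S : Finset V) :
    greedyPass G F (v :: l) S =
      greedyPass G F l (if v ∈ F ∧ ∀ s ∈ S, ¬ G.Adj s v then insert v S else S) := rfl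

theorem subset_greedyPass (G : SimpleGraph V) (F : Finset V) (l : List V) (S : Finset V) :
    S ⊆ greedyPass G F l S := by
  induction l generalizing S with
  | nil => exact subset_rfl
  | cons v l ih =>
    rw [greedyPass_cons]
    refine subset_trans ?_ (ih _)
    split_ifs
    · exact Finset.subset_insert _ _
    · exact subset_rfl

theorem greedyPass_subset {G : SimpleGraph V} {F : Finset V} (l : List V) {S : Finset V}
    (hS : S ⊆ F) : greedyPass G F l S ⊆ F := by
  induction l generalizing S with
  | nil => exact hS
  | cons v l ih =>
    rw [greedyPass_cons]
    refine ih ?_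
    split_ifs with h
    · exact Finset.insert_subset h.1 hS
    · exact hS

theorem greedyPass_indep {G : SimpleGraph V} {F : Finset V} (l : List V) {S : Finset V}
    (hS : ∀ u ∈ S, ∀ w ∈ S, ¬ G.Adj u w) :
    ∀ u ∈ greedyPass G F l S, ∀ w ∈ greedyPass G F l S, ¬ G.Adj u w := by
  induction l generalizing S with
  | nil => exact hS
  | cons v l ih =>
    rw [greedyPass_cons]
    refine ih ?_
    split_ifs with h
    · intro u hu w hw
      rcases Finset.mem_insert.1 hu with rfl | hu'
      · rcases Finset.mem_insert.1 hw with rfl | hw'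
        · exact G.irrefl
        · exact fun hadj => h.2 w hw' hadj.symm
      · rcases Finset.mem_insert.1 hw with rfl | hw'
        · exact h.2 u hu'
        · exact hS u hu' w hw'
    · exact hS

theorem greedyPass_dominates {G : SimpleGraph V} {F : Finset V} {l : List V} (S : Finset V)
    {v : V} (hl : v ∈ l) (hF : v ∈ F) :
    v ∈ greedyPass G F l S ∨ ∃ s ∈ greedyPass G F l S, G.Adj s v := by
  induction l generalizing S with
  | nil => simp at hl
  | cons w l ih =>
    rw [greedyPass_cons]
    rcases List.mem_cons.1 hl with rfl | hl
    · split_ifs with h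
      · exact Or.inl (subset_greedyPass _ _ _ _ (Finset.mem_insert_self _ _))
      · have : ∃ s ∈ S, G.Adj s v := by
          by_contra! hc
          exact h ⟨hF, hc⟩
        obtain ⟨s, hs, hadj⟩ := this
        exact Or.inr ⟨s, subset_greedyPass _ _ _ _ hs, hadj⟩
    · exact ih _ hl

/-- The pass only ever inspects pairs inside F. -/
theorem greedyPass_congr {G G' : SimpleGraph V} {F : Finset V}
    (hG : ∀ u ∈ F, ∀ w ∈ F, (G.Adj u w ↔ G'.Adj u w)) (l : List V) {S : Finset V} (hS : S ⊆ F) :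
    greedyPass G F l S = greedyPass G' F l S := by
  induction l generalizing S with
  | nil => rfl
  | cons v l ih =>
    rw [greedyPass_cons, greedyPass_cons]
    have hiff : (v ∈ F ∧ ∀ s ∈ S, ¬ G.Adj s v) ↔ (v ∈ F ∧ ∀ s ∈ S, ¬ G'.Adj s v) :=
      and_congr_right fun hv => forall₂_congr fun s hs => not_congr (hG s (hS hs) v hv)
    by_cases h : v ∈ F ∧ ∀ s ∈ S, ¬ G.Adj s v
    · rw [if_pos h, if_pos (hiff.1 h)]
      exact ih (Finset.insert_subset h.1 hS)
    · rw [if_neg h, if_neg (mt hiff.2 h)]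
      exact ih hS

theorem lfmis_subset (G : SimpleGraph V) (ord : Fin (Fintype.card V) ≃ V) (F : Finset V) :
    lfmis G ord F ⊆ F :=
  greedyPass_subset _ (Finset.empty_subset _)

theorem lfmis_indep (G : SimpleGraph V) (ord : Fin (Fintype.card V) ≃ V) (F : Finset V) :
    ∀ u ∈ lfmis G ord F, ∀ w ∈ lfmis G ord F, ¬ G.Adj u w :=
  greedyPass_indep _ (by simp)

theorem subset_coveredBy_lfmis (G : SimpleGraph V) (ord : Fin (Fintype.card V) ≃ V)
    (F : Finset V) : F ⊆ coveredBy G (lfmis G ord F) := by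
  intro v hv
  simp only [coveredBy, Finset.mem_filter, Finset.mem_univ, true_and]
  exact greedyPass_dominates ∅ (by simpa [List.mem_ofFn] using ord.surjective v) hv

theorem coveredBy_congr {G G' : SimpleGraph V} {S : Finset V}
    (hG : ∀ u ∈ S, ∀ w, (G.Adj u w ↔ G'.Adj u w)) : coveredBy G S = coveredBy G' S := by
  ext v
  simp only [coveredBy, Finset.mem_filter, Finset.mem_univ, true_and]
  exact or_congr_right (exists_congr fun s => and_congr_right fun hs => hG s hs v)

/-- A sampled vertex is in the independent set or adjacent to it, so it is deleted in its own
iteration. -/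
theorem notMem_of_mem_alive {G : SimpleGraph V} {ord : ℕ → Fin (Fintype.card V) ≃ V}
    {h : ℕ → Finset V} {i t : ℕ} (hi : i < t) {v : V} (hv : v ∈ alive G ord h t) : v ∉ h i := by
  intro hvi
  have hv' := alive_antitone G ord h (Nat.succ_le_of_lt hi) hv
  rw [Nat.succ_eq_add_one, alive, Finset.mem_sdiff] at hv'
  exact hv'.2 (subset_coveredBy_lfmis _ _ _ hvi)

/-- Changing edges between vertices that survive `t` iterations does not change the run. -/
theorem alive_congr_graph {G G' : SimpleGraph V} {ord : ℕ → Fin (Fintype.card V) ≃ V}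
    {h : ℕ → Finset V} {t : ℕ}
    (hG : ∀ u w, u ∉ alive G ord h t → (G.Adj u w ↔ G'.Adj u w)) {i : ℕ} (hi : i ≤ t) :
    alive G' ord h i = alive G ord h i := by
  induction i with
  | zero => rfl
  | succ i ih =>
    -- Both the greedy pass and the deletion of neighbours look only at pairs with a sampled end,
    -- and such an end is dead by time t, where the two graphs agree.
    have hF : ∀ u ∈ h i, u ∉ alive G ord h t := fun u hu hu' =>
      notMem_of_mem_alive (Nat.lt_of_succ_le hi) hu' hu
    have hmis : lfmis G (ord i) (h i) = lfmis G' (ord i) (h i) :=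
      greedyPass_congr (fun u hu w _ => hG u w (hF u hu)) _ (Finset.empty_subset _)
    rw [alive, alive, ih (by omega), ← hmis,
      coveredBy_congr fun u hu w => hG u w (hF u (lfmis_subset _ _ _ hu))]

end Lfmis

/-! ### Resampling and a Chernoff lower tail under bounded reweighting. -/

section Resampling

/-- Resampling principle: if replacing the part of `R` inside `E R` never changes `E`, it suffices
to compare `f` and `g` on each family `R₀ ∪ Y` with `Y ⊆ E R₀`. -/
theorem sum_le_of_resampling {α : Type*} [Fintype α] [DecidableEq α]
    (E : Finset α → Finset α) (hE : ∀ R, ∀ Y ⊆ E R, E (R \ E R ∪ Y) = E R)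
    (f g : Finset α → ℝ)
    (hfg : ∀ R, Disjoint R (E R) →
      ∑ Y ∈ (E R).powerset, f (R ∪ Y) ≤ ∑ Y ∈ (E R).powerset, g (R ∪ Y)) :
    ∑ R, f R ≤ ∑ R, g R := by
  classical
  -- Group by the part outside `E R`. Invariance of `E` makes each nonempty fibre exactly the family
  -- R₀ ∪ Y with Y ⊆ E R₀.
  rw [← Finset.sum_fiberwise Finset.univ (fun R => R \ E R) f,
    ← Finset.sum_fiberwise Finset.univ (fun R => R \ E R) g]
  refine Finset.sum_le_sum fun R₀ _ => ?_
  by_cases hR₀ : ∃ R, R \ E R = R₀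
  · obtain ⟨R, rfl⟩ := hR₀
    have hE0 : E (R \ E R) = E R := by simpa using hE R ∅ (Finset.empty_subset _)
    have hfib : Finset.univ.filter (fun R' => R' \ E R' = R \ E R) =
        (E R).powerset.image (fun Y => R \ E R ∪ Y) := by
      ext R'
      simp only [Finset.mem_filter, Finset.mem_univ, true_and, Finset.mem_image,
        Finset.mem_powerset]
      constructor
      · intro h
        have hE' : E R' = E R := by
          rw [← hE0, ← h]
          simpa using (hE R' ∅ (Finset.empty_subset _)).symm
        refine ⟨R' ∩ E R, Finset.inter_subset_right, ?_⟩
        rw [← h, hE', Finset.sdiff_union_inter]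
      · rintro ⟨Y, hY, rfl⟩
        rw [hE R Y hY, Finset.union_sdiff_distrib, Finset.sdiff_eq_empty_iff_subset.2 hY,
          Finset.union_empty, sdiff_idem]
    have hinj : Set.InjOn (fun Y => R \ E R ∪ Y) ((E R).powerset : Set (Finset α)) := by
      intro Y hY Y' hY' h
      simp only [Finset.coe_powerset, Set.mem_preimage, Set.mem_powerset_iff,
        Finset.coe_subset] at hY hY'
      have := congrArg (fun Z => Z ∩ E R) h
      simpa [Finset.union_inter_distrib_right, Finset.inter_eq_left.2 hY,
        Finset.inter_eq_left.2 hY', Finset.sdiff_inter_self] using this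
    rw [hfib, Finset.sum_image hinj, Finset.sum_image hinj]
    have := hfg (R \ E R)
    rw [hE0] at this
    exact this Finset.sdiff_disjoint
  · rw [Finset.filter_false_of_mem fun R _ h => hR₀ ⟨R, h⟩]
    simp

/-- The number of chosen elements of `B` is unlikely to be small, even after reweighting by
factors `a`, `b` and `w` that lie between `1 / 2` and `1`. -/
theorem sum_powerset_lower_tail {α : Type*} [DecidableEq α] (B : Finset α) {q D : ℝ}
    (hq0 : 0 ≤ q) (hq1 : q ≤ 1) (hD : 16 * D ≤ q * B.card)
    (a b : α → ℝ) (ha : ∀ u ∈ B, 1 / 2 ≤ a u ∧ a u ≤ 1) (hb : ∀ u ∈ B, 1 / 2 ≤ b u ∧ b u ≤ 1)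
    (w : Finset α → ℝ) (hw : ∀ Y ⊆ B, 1 / 2 ≤ w Y ∧ w Y ≤ 1) :
    ∑ Y ∈ B.powerset, (∏ u ∈ B, if u ∈ Y then q * a u else (1 - q) * b u) * w Y *
        (if (Y.card : ℝ) < 2 * D then 1 else 0) ≤
      2 * exp (-(q * B.card / 8)) *
        ∑ Y ∈ B.powerset, (∏ u ∈ B, if u ∈ Y then q * a u else (1 - q) * b u) * w Y := by
  have hsum : ∀ a' b' : α → ℝ, ∑ Y ∈ B.powerset, (∏ u ∈ B, if u ∈ Y then a' u else b' u) =
      ∏ u ∈ B, (a' u + b' u) := by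
    intro a' b'
    rw [Finset.prod_add]
    refine Finset.sum_congr rfl fun Y hY => ?_
    rw [Finset.prod_ite, Finset.filter_mem_eq_inter,
      Finset.inter_eq_right.2 (Finset.mem_powerset.1 hY), Finset.filter_notMem_eq_sdiff]
  have hx : ∀ u ∈ B, 0 ≤ q * a u := fun u hu => mul_nonneg hq0 (by linarith [(ha u hu).1])
  have hy : ∀ u ∈ B, 0 ≤ (1 - q) * b u := fun u hu =>
    mul_nonneg (by linarith) (by linarith [(hb u hu).1])
  have hpn : ∀ Y : Finset α, 0 ≤ ∏ u ∈ B, if u ∈ Y then q * a u else (1 - q) * b u := fun Y =>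
    Finset.prod_nonneg fun u hu => by split_ifs <;> [exact hx u hu; exact hy u hu]
  -- Markov's inequality for 2^(-|Y|): fewer than 2D ≤ q|B|/8 elements make exp(q|B|/8) · 2^(-|Y|)
  -- at least 1. The weight `w` is dropped here through w ≤ 1.
  have h1 : ∑ Y ∈ B.powerset, (∏ u ∈ B, if u ∈ Y then q * a u else (1 - q) * b u) * w Y *
        (if (Y.card : ℝ) < 2 * D then 1 else 0) ≤
      exp (q * B.card / 8) *
        ∑ Y ∈ B.powerset, ∏ u ∈ B, if u ∈ Y then q * a u / 2 else (1 - q) * b u := by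
    rw [Finset.mul_sum]
    refine Finset.sum_le_sum fun Y hY => ?_
    have hY := Finset.mem_powerset.1 hY
    have hhalf : (∏ u ∈ B, if u ∈ Y then q * a u / 2 else (1 - q) * b u) =
        (2 : ℝ)⁻¹ ^ Y.card * ∏ u ∈ B, if u ∈ Y then q * a u else (1 - q) * b u := by
      have h2 : (2 : ℝ)⁻¹ ^ Y.card = ∏ u ∈ B, if u ∈ Y then (2 : ℝ)⁻¹ else 1 := by
        rw [Finset.prod_ite]
        simp only [Finset.prod_const, one_pow, mul_one]
        rw [Finset.filter_mem_eq_inter, Finset.inter_eq_right.2 hY]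
      rw [h2, ← Finset.prod_mul_distrib]
      refine Finset.prod_congr rfl fun u _ => ?_
      split_ifs <;> ring
    rw [hhalf]
    have hP := hpn Y
    set P := ∏ u ∈ B, if u ∈ Y then q * a u else (1 - q) * b u
    have hwY := hw Y hY
    split_ifs with hc
    · have h3 : 1 ≤ exp (q * B.card / 8) * (2 : ℝ)⁻¹ ^ Y.card := by
        rw [← exp_log (show (0 : ℝ) < 2⁻¹ by norm_num), ← exp_nat_mul, ← exp_add, one_le_exp_iff,
          Real.log_inv]
        have hl := Real.log_two_lt_d9
        have hl' := Real.log_two_gt_d9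
        have : (Y.card : ℝ) * Real.log 2 ≤ Y.card * 1 :=
          mul_le_mul_of_nonneg_left (by linarith) (by positivity)
        linarith
      calc P * w Y * 1 ≤ P * 1 := by rw [mul_one]; exact mul_le_mul_of_nonneg_left hwY.2 hP
        _ ≤ P * (exp (q * B.card / 8) * (2 : ℝ)⁻¹ ^ Y.card) :=
          mul_le_mul_of_nonneg_left h3 hP
        _ = _ := by ring
    · rw [mul_zero]; positivity
  -- Halving the chosen term shrinks each factor by at least exp(-q/4): with a ≥ 1/2 the loss q a/2
  -- is at least q/4, while the whole factor is at most 1.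
  have h2 : ∏ u ∈ B, (q * a u / 2 + (1 - q) * b u) ≤
      exp (-(q * B.card / 4)) * ∏ u ∈ B, (q * a u + (1 - q) * b u) := by
    have : exp (-(q * B.card / 4)) = ∏ u ∈ B, exp (-(q / 4)) := by
      rw [Finset.prod_const, ← exp_nat_mul]
      congr 1
      ring
    rw [this, ← Finset.prod_mul_distrib]
    refine Finset.prod_le_prod (fun u hu => add_nonneg (by linarith [hx u hu]) (hy u hu))
      fun u hu => ?_
    have hle : q * a u + (1 - q) * b u ≤ 1 := by nlinarith [(ha u hu).2, (hb u hu).2]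
    have hge : q / 4 * (q * a u + (1 - q) * b u) ≤ q * a u / 2 := by
      nlinarith [(ha u hu).1, hx u hu, hy u hu]
    have he := add_one_le_exp (-(q / 4))
    nlinarith [mul_le_mul_of_nonneg_right he (add_nonneg (hx u hu) (hy u hu))]
  -- The weight `w` is put back through w ≥ 1/2, whence the factor 2.
  have h3 : ∏ u ∈ B, (q * a u + (1 - q) * b u) ≤
      2 * ∑ Y ∈ B.powerset, (∏ u ∈ B, if u ∈ Y then q * a u else (1 - q) * b u) * w Y := by
    rw [← hsum, Finset.mul_sum]
    refine Finset.sum_le_sum fun Y hY => ?_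
    nlinarith [hpn Y, (hw Y (Finset.mem_powerset.1 hY)).1]
  refine h1.trans ?_
  rw [hsum (fun u => q * a u / 2) (fun u => (1 - q) * b u)]
  have he : exp (q * B.card / 8) * exp (-(q * B.card / 4)) = exp (-(q * B.card / 8)) := by
    rw [← exp_add]
    congr 1
    ring
  calc _ ≤ exp (q * B.card / 8) * (exp (-(q * B.card / 4)) *
          ∏ u ∈ B, (q * a u + (1 - q) * b u)) :=
        mul_le_mul_of_nonneg_left h2 (exp_pos _).le
    _ = exp (-(q * B.card / 8)) * ∏ u ∈ B, (q * a u + (1 - q) * b u) := by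
        rw [← mul_assoc, he]
    _ ≤ _ := by
        rw [mul_comm 2 (exp _), mul_assoc]
        exact mul_le_mul_of_nonneg_left h3 (exp_pos _).le

end Resampling

/-! ### Few surviving neighbours are unlikely when the sampled sets are fixed. -/

section Switching

variable {k ℓ : ℕ}

/-- The unordered pair `v, u` listed with its lower level first. -/
def orientedPair (v u : HardVertex k ℓ) : HardVertex k ℓ × HardVertex k ℓ :=
  if v.1 < u.1 then (v, u) else (u, v)

/-- The end of the pair `e` that is not `v`. -/
def otherEnd (v : HardVertex k ℓ) (e : HardVertex k ℓ × HardVertex k ℓ) : HardVertex k ℓ :=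
  if e.1 = v then e.2 else e.1

theorem otherEnd_orientedPair {v u : HardVertex k ℓ} (h : u.1 ≠ v.1) :
    otherEnd v (orientedPair v u) = u := by
  have huv : u ≠ v := fun h' => h (by rw [h'])
  unfold orientedPair otherEnd
  split_ifs <;> simp_all

theorem orientedPair_eq_cases {v u x y : HardVertex k ℓ} (h : (x, y) = orientedPair v u) :
    (x = v ∧ y = u) ∨ (x = u ∧ y = v) := by
  unfold orientedPair at h
  split_ifs at h <;> simp_all

theorem pairProb_orientedPair {v u : HardVertex k ℓ} (h : u.1 ≠ v.1) :
    (pairProb k ℓ (orientedPair v u) : ℝ) = crossProb k ℓ (min (v.1 : ℕ) u.1) := by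
  unfold orientedPair pairProb
  rcases lt_or_gt_of_ne h with h1 | h1
  · rw [if_neg h1.not_gt, if_pos h1, min_eq_right (by exact_mod_cast h1.le)]
  · rw [if_pos h1, if_pos h1, min_eq_left (by exact_mod_cast h1.le)]

theorem layeredGraph_adj {R : Finset (HardVertex k ℓ × HardVertex k ℓ)} {u w : HardVertex k ℓ} :
    (layeredGraph k ℓ R).Adj u w ↔ u ≠ w ∧ (SameCluster u w ∨ (u, w) ∈ R ∨ (w, u) ∈ R) :=
  Iff.rfl

theorem layeredGraph_adj_congr {R R' : Finset (HardVertex k ℓ × HardVertex k ℓ)}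
    {u w : HardVertex k ℓ} (h1 : (u, w) ∈ R ↔ (u, w) ∈ R') (h2 : (w, u) ∈ R ↔ (w, u) ∈ R') :
    (layeredGraph k ℓ R).Adj u w ↔ (layeredGraph k ℓ R').Adj u w := by
  rw [layeredGraph_adj, layeredGraph_adj, h1, h2]

theorem layeredGraph_adj_of_orientedPair_mem {R : Finset (HardVertex k ℓ × HardVertex k ℓ)}
    {v u : HardVertex k ℓ} (huv : u.1 ≠ v.1) (h : orientedPair v u ∈ R) :
    (layeredGraph k ℓ R).Adj v u := by
  refine ⟨fun h' => huv (by rw [h']), Or.inr ?_⟩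
  unfold orientedPair at h
  split_ifs at h
  · exact Or.inl h
  · exact Or.inr h

/-- The vertices of `A` in level `m`. -/
def levelPart (A : Finset (HardVertex k ℓ)) (m : ℕ) : Finset (HardVertex k ℓ) :=
  A.filter fun v => (v.1 : ℕ) = m

theorem mem_levelPart {A : Finset (HardVertex k ℓ)} {m : ℕ} {v : HardVertex k ℓ} :
    v ∈ levelPart A m ↔ v ∈ A ∧ (v.1 : ℕ) = m := by
  simp [levelPart]

/-- The sampling probabilities of a rule that only looks at the active neighbourhood. -/
noncomputable def localProb
    (ρ : ℕ → Finset (HardVertex k ℓ) → HardVertex k ℓ → Finset (HardVertex k ℓ) → ℝ)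
    (G : SimpleGraph (HardVertex k ℓ)) (i : ℕ) (A : Finset (HardVertex k ℓ))
    (v : HardVertex k ℓ) : ℝ :=
  if v ∈ A then ρ i A v (remNbrs G A v) else 0

section Rule

variable (ord : ℕ → Fin (Fintype.card (HardVertex k ℓ)) ≃ HardVertex k ℓ)
  (ρ : ℕ → Finset (HardVertex k ℓ) → HardVertex k ℓ → Finset (HardVertex k ℓ) → ℝ)

theorem localProb_nonneg {ρ : ℕ → Finset (HardVertex k ℓ) → HardVertex k ℓ →
      Finset (HardVertex k ℓ) → ℝ} (h0 : ∀ i A v nb, 0 ≤ ρ i A v nb)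
    (G : SimpleGraph (HardVertex k ℓ)) (i : ℕ) (A : Finset (HardVertex k ℓ))
    (v : HardVertex k ℓ) : 0 ≤ localProb ρ G i A v := by
  unfold localProb
  split_ifs <;> [exact h0 _ _ _ _; exact le_rfl]

theorem localProb_le {ρ : ℕ → Finset (HardVertex k ℓ) → HardVertex k ℓ →
      Finset (HardVertex k ℓ) → ℝ} {c : ℕ → ℝ} (hc0 : ∀ i, 0 ≤ c i)
    (hc : ∀ i A v nb, ρ i A v nb ≤ c i) (G : SimpleGraph (HardVertex k ℓ)) (i : ℕ)
    (A : Finset (HardVertex k ℓ)) (v : HardVertex k ℓ) : localProb ρ G i A v ≤ c i := by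
  unfold localProb
  split_ifs <;> [exact hc _ _ _ _; exact hc0 i]

/-- The contribution of the vertex `u` to the probability of the sampled sets `h`. -/
noncomputable def vertexFactor (G : SimpleGraph (HardVertex k ℓ))
    (h : ℕ → Finset (HardVertex k ℓ)) (t : ℕ) (u : HardVertex k ℓ) : ℝ :=
  ∏ i ∈ Finset.range t, if u ∈ h i then localProb ρ G i (alive G ord h i) u
    else 1 - localProb ρ G i (alive G ord h i) u

/-- Regrouping the probability of a history by vertex instead of by iteration makes the effect of a
changed edge local to its two ends. -/
theorem sampleWeight_eq_prod_vertexFactor (G : SimpleGraph (HardVertex k ℓ))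
    (h : ℕ → Finset (HardVertex k ℓ)) (t : ℕ) :
    sampleWeight G ord (localProb ρ G) h t = ∏ u, vertexFactor ord ρ G h t u := by
  unfold sampleWeight subsetWeight vertexFactor
  exact Finset.prod_comm

/-- A survivor was never sampled, so only factors 1 - p occur, each between 1 - c i and 1. -/
theorem vertexFactor_mem {ρ : ℕ → Finset (HardVertex k ℓ) → HardVertex k ℓ →
      Finset (HardVertex k ℓ) → ℝ} {c : ℕ → ℝ} (hc0 : ∀ i, 0 ≤ c i) (hc1 : ∀ i, c i ≤ 1)
    (h0 : ∀ i A v nb, 0 ≤ ρ i A v nb) (hc : ∀ i A v nb, ρ i A v nb ≤ c i) {t : ℕ}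
    (hct : 1 / 2 ≤ ∏ i ∈ Finset.range t, (1 - c i)) (G : SimpleGraph (HardVertex k ℓ))
    (h : ℕ → Finset (HardVertex k ℓ)) {u : HardVertex k ℓ} (hu : u ∈ alive G ord h t) :
    1 / 2 ≤ vertexFactor ord ρ G h t u ∧ vertexFactor ord ρ G h t u ≤ 1 := by
  have heq : vertexFactor ord ρ G h t u =
      ∏ i ∈ Finset.range t, (1 - localProb ρ G i (alive G ord h i) u) :=
    Finset.prod_congr rfl fun i hi => if_neg (notMem_of_mem_alive (Finset.mem_range.1 hi) hu)
  rw [heq]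
  constructor
  · refine hct.trans (Finset.prod_le_prod (fun i _ => by linarith [hc1 i]) fun i _ => ?_)
    linarith [localProb_le hc0 hc G i (alive G ord h i) u]
  · refine Finset.prod_le_one (fun i _ => ?_) fun i _ => ?_
    · linarith [localProb_le hc0 hc G i (alive G ord h i) u, hc1 i]
    · linarith [localProb_nonneg h0 G i (alive G ord h i) u]

/-- This is where locality of the rule is used: given the active sets, the factor of u reads only
the edges at u. -/
theorem vertexFactor_congr {G G' : SimpleGraph (HardVertex k ℓ)}
    {h : ℕ → Finset (HardVertex k ℓ)} {t : ℕ} {u : HardVertex k ℓ}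
    (hA : ∀ i ≤ t, alive G ord h i = alive G' ord h i)
    (hadj : ∀ w, (G.Adj u w ↔ G'.Adj u w)) :
    vertexFactor ord ρ G h t u = vertexFactor ord ρ G' h t u := by
  refine Finset.prod_congr rfl fun i hi => ?_
  have hP : localProb ρ G i (alive G ord h i) u = localProb ρ G' i (alive G' ord h i) u := by
    unfold localProb
    rw [hA i (Finset.mem_range.1 hi).le, remNbrs_congr fun w _ => hadj w]
  rw [hP]

/-- With the sampled sets `h` held fixed, a surviving vertex `v` rarely has few surviving
neighbours in a level `m` of which many vertices survive. -/
theorem sum_few_survivors_le {c : ℕ → ℝ} (hc0 : ∀ i, 0 ≤ c i) (hc1 : ∀ i, c i ≤ 1)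
    (h0 : ∀ i A v nb, 0 ≤ ρ i A v nb) (hc : ∀ i A v nb, ρ i A v nb ≤ c i) {t : ℕ}
    (hct : 1 / 2 ≤ ∏ i ∈ Finset.range t, (1 - c i)) (h : ℕ → Finset (HardVertex k ℓ))
    (v : HardVertex k ℓ) {m : ℕ} (hm : m ≠ v.1) {b D : ℝ}
    (hD : 16 * D ≤ crossProb k ℓ (min (v.1 : ℕ) m) * b) :
    (∑ R, subsetWeight (fun e => (pairProb k ℓ e : ℝ)) R *
      (sampleWeight (layeredGraph k ℓ R) ord (localProb ρ (layeredGraph k ℓ R)) h t *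
        if v ∈ alive (layeredGraph k ℓ R) ord h t ∧
          b ≤ (levelPart (alive (layeredGraph k ℓ R) ord h t) m).card ∧
          ((levelPart (remNbrs (layeredGraph k ℓ R) (alive (layeredGraph k ℓ R) ord h t) v)
            m).card : ℝ) < 2 * D then 1 else 0)) ≤
    ∑ R, 2 * exp (-(crossProb k ℓ (min (v.1 : ℕ) m) * b / 8)) *
      (subsetWeight (fun e => (pairProb k ℓ e : ℝ)) R *
      sampleWeight (layeredGraph k ℓ R) ord (localProb ρ (layeredGraph k ℓ R)) h t) := by
  classical
  set q := crossProb k ℓ (min (v.1 : ℕ) m) with hq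
  obtain ⟨hq0, hq1⟩ := crossProb_mem k ℓ (min (v.1 : ℕ) m)
  rw [← hq] at hq0 hq1
  set A : Finset (HardVertex k ℓ × HardVertex k ℓ) → Finset (HardVertex k ℓ) :=
    fun R => alive (layeredGraph k ℓ R) ord h t with hA
  have hbwn : ∀ R, 0 ≤ subsetWeight (fun e => (pairProb k ℓ e : ℝ)) R := fun R =>
    subsetWeight_nonneg (fun e => (pairProb k ℓ e).2.1) (fun e => (pairProb k ℓ e).2.2) R
  have hswn : ∀ R, 0 ≤ sampleWeight (layeredGraph k ℓ R) ord
      (localProb ρ (layeredGraph k ℓ R)) h t := fun R =>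
    sampleWeight_nonneg (localProb_nonneg h0 _)
      (fun i A v => (localProb_le hc0 hc _ i A v).trans (hc1 i)) h t
  -- The condition and the set refer to R only through the surviving set, which resampling these
  -- pairs does not change; so `E` is invariant, as the resampling principle demands.
  set E : Finset (HardVertex k ℓ × HardVertex k ℓ) → Finset (HardVertex k ℓ × HardVertex k ℓ) :=
    fun R => if v ∈ A R ∧ b ≤ (levelPart (A R) m).card then
      (levelPart (A R) m).image (orientedPair v) else ∅ with hEdef
  -- the resampled pairs join `v` to a surviving vertex of level `m`
  have hEmem : ∀ {R x y}, (x, y) ∈ E R → v ∈ A R ∧ ∃ u ∈ A R, (u.1 : ℕ) = m ∧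
      orientedPair v u = (x, y) ∧ ((x = v ∧ y = u) ∨ (x = u ∧ y = v)) := by
    intro R x y hxy
    simp only [hEdef] at hxy
    split_ifs at hxy with hcond
    · obtain ⟨u, hu, hpair⟩ := Finset.mem_image.1 hxy
      obtain ⟨huA, hum⟩ := mem_levelPart.1 hu
      exact ⟨hcond.1, u, huA, hum, hpair, orientedPair_eq_cases hpair.symm⟩
    · simp at hxy
  have halive : ∀ R R', (∀ e, e ∉ E R → (e ∈ R ↔ e ∈ R')) → ∀ i ≤ t,
      alive (layeredGraph k ℓ R') ord h i = alive (layeredGraph k ℓ R) ord h i := by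
    intro R R' hRR' i hi
    refine alive_congr_graph (fun u w hu => ?_) hi
    refine layeredGraph_adj_congr (hRR' _ fun hE => hu ?_) (hRR' _ fun hE => hu ?_)
    · obtain ⟨hv, u', hu', -, -, ⟨rfl, rfl⟩ | ⟨rfl, rfl⟩⟩ := hEmem hE
      · exact hv
      · exact hu'
    · obtain ⟨hv, u', hu', -, -, ⟨rfl, rfl⟩ | ⟨rfl, rfl⟩⟩ := hEmem hE
      · exact hu'
      · exact hv
  refine sum_le_of_resampling E ?_ _ _ ?_
  · intro R Y hY
    have hAeq : A (R \ E R ∪ Y) = A R := by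
      refine halive R _ (fun e he => ?_) t le_rfl
      have : e ∉ Y := fun h' => he (hY h')
      simp [he, this]
    simp only [hEdef] at hAeq ⊢
    rw [hAeq]
  intro R hdisj
  by_cases hcond : v ∈ A R ∧ b ≤ (levelPart (A R) m).card
  swap
  · have hE0 : E R = ∅ := if_neg hcond
    simp only [hE0, Finset.powerset_empty, Finset.sum_singleton, Finset.union_empty]
    rw [if_neg fun h' => hcond ⟨h'.1, h'.2.1⟩]
    simp only [mul_zero]
    exact mul_nonneg (by positivity) (mul_nonneg (hbwn R) (hswn R))
  obtain ⟨hvA, hbB⟩ := hcond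
  set B := levelPart (A R) m with hB
  have hER : E R = B.image (orientedPair v) := if_pos ⟨hvA, hbB⟩
  have hBne : ∀ u ∈ B, u.1 ≠ v.1 := fun u hu h' => hm (by
    rw [← (mem_levelPart.1 hu).2, h'])
  have hinj : Set.InjOn (orientedPair v) (B : Set (HardVertex k ℓ)) := fun u hu u' hu' heq => by
    rw [← otherEnd_orientedPair (hBne u hu), heq, otherEnd_orientedPair (hBne u' hu')]
  have hcard : (E R).card = B.card := by rw [hER, Finset.card_image_of_injOn hinj]
  have hother : ∀ e ∈ E R, otherEnd v e ∈ B ∧ orientedPair v (otherEnd v e) = e := by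
    intro e he
    rw [hER] at he
    obtain ⟨u, hu, rfl⟩ := Finset.mem_image.1 he
    rw [otherEnd_orientedPair (hBne u hu)]
    exact ⟨hu, rfl⟩
  -- All graphs in the fibre share one run, so survivors and `B` are fixed while Y varies.
  have haliveY : ∀ Y ⊆ E R, ∀ i ≤ t, alive (layeredGraph k ℓ (R ∪ Y)) ord h i =
      alive (layeredGraph k ℓ R) ord h i := fun Y hY =>
    halive R _ fun e he => by
      have : e ∉ Y := fun h' => he (hY h')
      simp [this]
  have hfacmem : ∀ Y ⊆ E R, ∀ u ∈ A R, 1 / 2 ≤ vertexFactor ord ρ (layeredGraph k ℓ (R ∪ Y)) h t u ∧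
      vertexFactor ord ρ (layeredGraph k ℓ (R ∪ Y)) h t u ≤ 1 := fun Y hY u hu =>
    vertexFactor_mem ord hc0 hc1 h0 hc hct _ h (by rw [haliveY Y hY t le_rfl]; exact hu)
  -- factors of vertices that see none of the resampled pairs
  have hrest : ∀ Y ⊆ E R, ∀ u, u ≠ v → u ∉ B →
      vertexFactor ord ρ (layeredGraph k ℓ (R ∪ Y)) h t u =
        vertexFactor ord ρ (layeredGraph k ℓ R) h t u := by
    intro Y hY u huv huB
    refine vertexFactor_congr ord ρ (haliveY Y hY) fun w => ?_
    have key : ∀ e ∈ Y, e ≠ (u, w) ∧ e ≠ (w, u) := by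
      intro e he
      constructor
      · rintro rfl
        obtain ⟨-, u', hu', hum, -, ⟨rfl, rfl⟩ | ⟨rfl, rfl⟩⟩ := hEmem (hY he)
        · exact huv rfl
        · exact huB (mem_levelPart.2 ⟨hu', hum⟩)
      · rintro rfl
        obtain ⟨-, u', hu', hum, -, ⟨rfl, rfl⟩ | ⟨rfl, rfl⟩⟩ := hEmem (hY he)
        · exact huB (mem_levelPart.2 ⟨hu', hum⟩)
        · exact huv rfl
    refine layeredGraph_adj_congr ?_ ?_
    · have : (u, w) ∉ Y := fun h' => (key _ h').1 rfl
      simp [this]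
    · have : (w, u) ∉ Y := fun h' => (key _ h').2 rfl
      simp [this]
  -- factors of the vertices of `B` depend on a single resampled pair
  have hpairfac : ∀ Y ⊆ E R, ∀ Y' ⊆ E R, ∀ e ∈ E R, (e ∈ Y ↔ e ∈ Y') →
      vertexFactor ord ρ (layeredGraph k ℓ (R ∪ Y)) h t (otherEnd v e) =
        vertexFactor ord ρ (layeredGraph k ℓ (R ∪ Y')) h t (otherEnd v e) := by
    intro Y hY Y' hY' e he hiff
    refine vertexFactor_congr ord ρ
      (fun i hi => by rw [haliveY Y hY i hi, haliveY Y' hY' i hi]) fun w => ?_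
    have huB := (hother e he).1
    have hne := hBne _ huB
    have key : ∀ e' ∈ E R, (e' = (otherEnd v e, w) ∨ e' = (w, otherEnd v e)) → e' = e := by
      rintro e' he' (rfl | rfl)
      · obtain ⟨-, u', hu', hum, hp, ⟨h1, h2⟩ | ⟨h1, h2⟩⟩ := hEmem he'
        · exact absurd (by rw [h1]) hne
        · rw [← hp, ← h1, (hother e he).2]
      · obtain ⟨-, u', hu', hum, hp, ⟨h1, h2⟩ | ⟨h1, h2⟩⟩ := hEmem he'
        · rw [← hp, ← h2, (hother e he).2]
        · exact absurd (by rw [h2]) hne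
    have key' : ∀ e', (e' = (otherEnd v e, w) ∨ e' = (w, otherEnd v e)) →
        (e' ∈ R ∪ Y ↔ e' ∈ R ∪ Y') := by
      intro e' he'
      rw [Finset.mem_union, Finset.mem_union]
      refine or_congr_right ⟨fun hh => ?_, fun hh => ?_⟩
      · have := key e' (hY hh) he'
        rw [this] at hh ⊢
        exact hiff.1 hh
      · have := key e' (hY' hh) he'
        rw [this] at hh ⊢
        exact hiff.2 hh
    exact layeredGraph_adj_congr (key' _ (Or.inl rfl)) (key' _ (Or.inr rfl))
  -- Every resampled pair joins the level of v to level m, so all have the same edge probability q.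
  have hbw : ∀ Y ⊆ E R, subsetWeight (fun e => (pairProb k ℓ e : ℝ)) (R ∪ Y) =
      (∏ e ∈ (E R)ᶜ, if e ∈ R then (pairProb k ℓ e : ℝ) else 1 - pairProb k ℓ e) *
        ∏ e ∈ E R, if e ∈ Y then q else 1 - q := by
    intro Y hY
    unfold subsetWeight
    rw [← Finset.prod_compl_mul_prod (E R)]
    congr 1
    · refine Finset.prod_congr rfl fun e he => ?_
      have : e ∉ Y := fun h' => (Finset.mem_compl.1 he) (hY h')
      simp [this]
    · refine Finset.prod_congr rfl fun e he => ?_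
      have heR : e ∉ R := fun h' => Finset.disjoint_left.1 hdisj h' he
      have hpe : (pairProb k ℓ e : ℝ) = q := by
        obtain ⟨h1, h2⟩ := hother e he
        rw [← h2, pairProb_orientedPair (hBne _ h1), (mem_levelPart.1 h1).2]
      simp [heR, hpe]
  have hvB : v ∉ B := fun h' => hBne v h' rfl
  -- The factor of a vertex of `B` depends only on whether its own pair lies in Y, so it may be
  -- evaluated at the extreme choices Y = E R and Y = ∅. Only the factor of v depends on all of Y;
  -- it plays the role of the weight `w` in the lower tail.
  have hsw : ∀ Y ⊆ E R, sampleWeight (layeredGraph k ℓ (R ∪ Y)) ord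
        (localProb ρ (layeredGraph k ℓ (R ∪ Y))) h t =
      (∏ u ∈ (insert v B)ᶜ, vertexFactor ord ρ (layeredGraph k ℓ R) h t u) *
        ((∏ e ∈ E R, if e ∈ Y then
            vertexFactor ord ρ (layeredGraph k ℓ (R ∪ E R)) h t (otherEnd v e)
          else vertexFactor ord ρ (layeredGraph k ℓ (R ∪ ∅)) h t (otherEnd v e)) *
          vertexFactor ord ρ (layeredGraph k ℓ (R ∪ Y)) h t v) := by
    intro Y hY
    rw [sampleWeight_eq_prod_vertexFactor, ← Finset.prod_compl_mul_prod (insert v B),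
      Finset.prod_insert hvB, mul_comm (vertexFactor ord ρ _ h t v)]
    congr 1
    · refine Finset.prod_congr rfl fun u hu => ?_
      simp only [Finset.mem_compl, Finset.mem_insert, not_or] at hu
      exact hrest Y hY u hu.1 hu.2
    · congr 1
      have : ∏ u ∈ B, vertexFactor ord ρ (layeredGraph k ℓ (R ∪ Y)) h t u =
          ∏ e ∈ E R, vertexFactor ord ρ (layeredGraph k ℓ (R ∪ Y)) h t (otherEnd v e) := by
        rw [hER, Finset.prod_image hinj]
        refine Finset.prod_congr rfl fun u hu => ?_
        rw [otherEnd_orientedPair (hBne u hu)]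
      rw [this]
      refine Finset.prod_congr rfl fun e he => ?_
      split_ifs with heY
      · exact hpairfac Y hY _ subset_rfl e he (by simp [heY, he])
      · exact hpairfac Y hY _ (Finset.empty_subset _) e he (by simp [heY])
  -- Each chosen pair supplies a distinct surviving neighbour of v in level m, so few neighbours
  -- force few chosen pairs.
  have hind : ∀ Y ⊆ E R, ((levelPart (remNbrs (layeredGraph k ℓ (R ∪ Y)) (A R) v) m).card : ℝ) <
      2 * D → (Y.card : ℝ) < 2 * D := by
    intro Y hY
    refine lt_of_le_of_lt ?_
    have hsub : Y.image (otherEnd v) ⊆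
        levelPart (remNbrs (layeredGraph k ℓ (R ∪ Y)) (A R) v) m := by
      intro u hu
      obtain ⟨e, he, rfl⟩ := Finset.mem_image.1 hu
      obtain ⟨h1, h2⟩ := hother e (hY he)
      refine mem_levelPart.2 ⟨mem_remNbrs.2 ⟨(mem_levelPart.1 h1).1, ?_⟩, (mem_levelPart.1 h1).2⟩
      exact layeredGraph_adj_of_orientedPair_mem (hBne _ h1)
        (by rw [h2]; exact Finset.mem_union_right _ he)
    have hinj' : Set.InjOn (otherEnd v) (Y : Set (HardVertex k ℓ × HardVertex k ℓ)) :=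
      fun e he e' he' heq => by
        rw [← (hother e (hY he)).2, heq, (hother e' (hY he')).2]
    rw [← Finset.card_image_of_injOn hinj']
    exact_mod_cast Finset.card_le_card hsub
  have htail := sum_powerset_lower_tail (E R) hq0 hq1 (D := D)
    (by rw [hcard]; exact hD.trans (mul_le_mul_of_nonneg_left hbB hq0))
    (fun e => vertexFactor ord ρ (layeredGraph k ℓ (R ∪ E R)) h t (otherEnd v e))
    (fun e => vertexFactor ord ρ (layeredGraph k ℓ (R ∪ ∅)) h t (otherEnd v e))
    (fun e he => hfacmem _ subset_rfl _ (mem_levelPart.1 (hother e he).1).1)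
    (fun e he => hfacmem _ (Finset.empty_subset _) _ (mem_levelPart.1 (hother e he).1).1)
    (fun Y => vertexFactor ord ρ (layeredGraph k ℓ (R ∪ Y)) h t v)
    (fun Y hY => hfacmem Y hY v hvA)
  set C1 := ∏ e ∈ (E R)ᶜ, if e ∈ R then (pairProb k ℓ e : ℝ) else 1 - pairProb k ℓ e with hC1
  set C2 := ∏ u ∈ (insert v B)ᶜ, vertexFactor ord ρ (layeredGraph k ℓ R) h t u with hC2
  have hC1n : 0 ≤ C1 := Finset.prod_nonneg fun e _ => by
    split_ifs
    · exact (pairProb k ℓ e).2.1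
    · linarith [(pairProb k ℓ e).2.2]
  have hC2n : 0 ≤ C2 := Finset.prod_nonneg fun u _ => Finset.prod_nonneg fun i _ => by
    have h1 := localProb_nonneg h0 (layeredGraph k ℓ R) i (alive (layeredGraph k ℓ R) ord h i) u
    have h2 := localProb_le hc0 hc (layeredGraph k ℓ R) i (alive (layeredGraph k ℓ R) ord h i) u
    split_ifs <;> linarith [hc1 i]
  have hweights : ∀ Y ⊆ E R, subsetWeight (fun e => (pairProb k ℓ e : ℝ)) (R ∪ Y) *
      sampleWeight (layeredGraph k ℓ (R ∪ Y)) ord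
        (localProb ρ (layeredGraph k ℓ (R ∪ Y))) h t =
      (C1 * C2) * ((∏ e ∈ E R, if e ∈ Y then
          q * vertexFactor ord ρ (layeredGraph k ℓ (R ∪ E R)) h t (otherEnd v e)
        else (1 - q) * vertexFactor ord ρ (layeredGraph k ℓ (R ∪ ∅)) h t (otherEnd v e)) *
        vertexFactor ord ρ (layeredGraph k ℓ (R ∪ Y)) h t v) := by
    intro Y hY
    rw [hbw Y hY, hsw Y hY]
    have : ∀ a b : HardVertex k ℓ × HardVertex k ℓ → ℝ,
        (∏ e ∈ E R, if e ∈ Y then q * a e else (1 - q) * b e) =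
        (∏ e ∈ E R, if e ∈ Y then q else 1 - q) * ∏ e ∈ E R, if e ∈ Y then a e else b e := by
      intro a b
      rw [← Finset.prod_mul_distrib]
      refine Finset.prod_congr rfl fun e _ => ?_
      split_ifs <;> rfl
    rw [this]
    ring
  have hn : 0 ≤ C1 * C2 := mul_nonneg hC1n hC2n
  calc _ ≤ ∑ Y ∈ (E R).powerset, (C1 * C2) * ((∏ e ∈ E R, if e ∈ Y then
          q * vertexFactor ord ρ (layeredGraph k ℓ (R ∪ E R)) h t (otherEnd v e)
        else (1 - q) * vertexFactor ord ρ (layeredGraph k ℓ (R ∪ ∅)) h t (otherEnd v e)) *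
        vertexFactor ord ρ (layeredGraph k ℓ (R ∪ Y)) h t v *
        if (Y.card : ℝ) < 2 * D then 1 else 0) := by
        refine Finset.sum_le_sum fun Y hY => ?_
        have hY := Finset.mem_powerset.1 hY
        rw [← mul_assoc, hweights Y hY]
        have hAY : A (R ∪ Y) = A R := haliveY Y hY t le_rfl
        have hnn : 0 ≤ (C1 * C2) * ((∏ e ∈ E R, if e ∈ Y then
            q * vertexFactor ord ρ (layeredGraph k ℓ (R ∪ E R)) h t (otherEnd v e)
          else (1 - q) * vertexFactor ord ρ (layeredGraph k ℓ (R ∪ ∅)) h t (otherEnd v e)) *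
          vertexFactor ord ρ (layeredGraph k ℓ (R ∪ Y)) h t v) := by
          rw [← hweights Y hY]
          exact mul_nonneg (hbwn _) (hswn _)
        rw [← mul_assoc (C1 * C2) _ (if (Y.card : ℝ) < 2 * D then (1 : ℝ) else 0)]
        refine mul_le_mul_of_nonneg_left ?_ hnn
        split_ifs with h1 h2 h2
        · exact le_rfl
        · have h3 := h1.2.2
          change ((levelPart (remNbrs (layeredGraph k ℓ (R ∪ Y)) (A (R ∪ Y)) v) m).card : ℝ) <
            2 * D at h3
          rw [hAY] at h3
          exact absurd (hind Y hY h3) h2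
        · exact zero_le_one
        · exact le_rfl
    _ ≤ (C1 * C2) * (2 * exp (-(q * (E R).card / 8)) *
        ∑ Y ∈ (E R).powerset, (∏ e ∈ E R, if e ∈ Y then
          q * vertexFactor ord ρ (layeredGraph k ℓ (R ∪ E R)) h t (otherEnd v e)
        else (1 - q) * vertexFactor ord ρ (layeredGraph k ℓ (R ∪ ∅)) h t (otherEnd v e)) *
        vertexFactor ord ρ (layeredGraph k ℓ (R ∪ Y)) h t v) := by
        rw [← Finset.mul_sum]
        exact mul_le_mul_of_nonneg_left htail hn
    _ = ∑ Y ∈ (E R).powerset, 2 * exp (-(q * (E R).card / 8)) *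
        (subsetWeight (fun e => (pairProb k ℓ e : ℝ)) (R ∪ Y) *
          sampleWeight (layeredGraph k ℓ (R ∪ Y)) ord
            (localProb ρ (layeredGraph k ℓ (R ∪ Y))) h t) := by
        rw [← Finset.mul_sum, Finset.sum_congr rfl fun Y hY =>
          hweights Y (Finset.mem_powerset.1 hY), ← Finset.mul_sum]
        ring
    _ ≤ _ := by
        refine Finset.sum_le_sum fun Y _ => mul_le_mul_of_nonneg_right ?_
          (mul_nonneg (hbwn _) (hswn _))
        refine mul_le_mul_of_nonneg_left ?_ (by norm_num)
        rw [exp_le_exp, hcard]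
        have := mul_le_mul_of_nonneg_left hbB hq0
        linarith

end Rule

end Switching

/-! ### Deterministic bounds on sizes, probabilities and surviving levels. -/

section SizeBounds

/-- The real number `k ^ (1 / 4 ^ i)`, which `clusterSize k i` rounds down. -/
noncomputable def realSize (k i : ℕ) : ℝ := (k : ℝ) ^ ((1 : ℝ) / 4 ^ i)

/-- The logarithm of the number of vertices. -/
noncomputable def logSize (k ℓ : ℕ) : ℝ := logb 2 ((k : ℝ) * ℓ)

/-- The numerical relations between the parameters that the probabilistic argument uses. -/
structure Regime (k ℓ : ℕ) (η : ℝ) : Prop where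
  one_le_k : 1 ≤ k
  three_le : 3 ≤ ℓ
  one_le_log : 1 ≤ logSize k ℓ
  sq_le : 20 * (ℓ : ℝ) ^ 2 ≤ logSize k ℓ ^ 2
  size : ∀ i < ℓ, 64 * (ℓ : ℝ) ^ 2 * logSize k ℓ ^ 3 ≤ realSize k i
  exponent : ∀ i < ℓ, 16 * logSize k ℓ ^ 2 * η ≤ realSize k i
  exponent_le_sqrt : η ≤ √k
  exponent_nonneg : 0 ≤ η

/-- An upper bound for the sampling probabilities of iteration `i`. -/
noncomputable def sampleCap (k ℓ i : ℕ) : ℝ :=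
  -- The reciprocal square root of the degree bound s_i/(16 L²).
  if i < ℓ then 4 * logSize k ℓ / √(realSize k i) else 0

/-- The ratio 4 of consecutive exponents gives √s_i = s_{i+1}²: a sample of density about 1/√s_i is
too sparse to exhaust level i + 1, where a vertex covers about s_{i+1} others. -/
theorem realSize_succ (k i : ℕ) : realSize k i = realSize k (i + 1) ^ 4 := by
  unfold realSize
  rw [← rpow_mul_natCast (by positivity)]
  congr 1
  rw [pow_succ]
  push_cast
  field_simp

theorem realSize_antitone {k : ℕ} (hk : 1 ≤ k) : Antitone (realSize k) := by
  intro i j hij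
  refine rpow_le_rpow_of_exponent_le (by exact_mod_cast hk) ?_
  exact one_div_le_one_div_of_le (by positivity) (pow_le_pow_right₀ (by norm_num) hij)

theorem one_le_realSize {k : ℕ} (hk : 1 ≤ k) (i : ℕ) : 1 ≤ realSize k i :=
  one_le_rpow (by exact_mod_cast hk) (by positivity)

theorem realSize_le {k : ℕ} (hk : 1 ≤ k) (i : ℕ) : realSize k i ≤ k := by
  have := realSize_antitone hk (Nat.zero_le i)
  simpa [realSize] using this

theorem mul_crossProb {k : ℕ} (hk : 1 ≤ k) (ℓ i : ℕ) :
    k * crossProb k ℓ i = realSize k i / logSize k ℓ ^ 2 := by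
  have hk' : (0 : ℝ) < k := by exact_mod_cast hk
  unfold crossProb realSize logSize
  rw [rpow_sub hk', rpow_one]
  field_simp

theorem crossProb_antitone {k : ℕ} (hk : 1 ≤ k) (ℓ : ℕ) : Antitone (crossProb k ℓ) := by
  intro i j hij
  have hk' : (0 : ℝ) < k := by exact_mod_cast hk
  have := div_le_div_of_nonneg_right (realSize_antitone hk hij) (sq_nonneg (logSize k ℓ))
  rw [← mul_crossProb hk, ← mul_crossProb hk] at this
  exact le_of_mul_le_mul_left this hk'

theorem sampleCap_nonneg {k ℓ : ℕ} (hL : 0 ≤ logSize k ℓ) (i : ℕ) : 0 ≤ sampleCap k ℓ i := by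
  unfold sampleCap
  split_ifs <;> positivity

theorem Regime.mul_sampleCap_le {k ℓ : ℕ} {η : ℝ} (H : Regime k ℓ η) (i : ℕ) :
    ℓ * sampleCap k ℓ i ≤ 1 / 2 := by
  unfold sampleCap
  split_ifs with hi
  · have hL := H.one_le_log
    have hs := one_le_realSize H.one_le_k i
    have h1 : 8 * ℓ * logSize k ℓ ≤ √(realSize k i) := by
      refine le_sqrt_of_sq_le (le_trans ?_ (H.size i hi))
      rw [show (8 * ℓ * logSize k ℓ) ^ 2 = 64 * (ℓ : ℝ) ^ 2 * logSize k ℓ ^ 2 by ring]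
      exact mul_le_mul_of_nonneg_left (pow_le_pow_right₀ hL (by norm_num)) (by positivity)
    have h2 : 0 < √(realSize k i) := sqrt_pos.2 (by linarith)
    rw [mul_div_assoc', div_le_iff₀ h2]
    linarith
  · simp

theorem Regime.sampleCap_le_one {k ℓ : ℕ} {η : ℝ} (H : Regime k ℓ η) (i : ℕ) :
    sampleCap k ℓ i ≤ 1 := by
  have h1 := H.mul_sampleCap_le i
  have h2 : (3 : ℝ) ≤ ℓ := by exact_mod_cast H.three_le
  nlinarith [sampleCap_nonneg (k := k) (ℓ := ℓ) (by linarith [H.one_le_log]) i]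

/-- Each cap is at most 1/(2ℓ), so over at most ℓ iterations the caps sum to at most 1/2. -/
theorem Regime.half_le_prod {k ℓ : ℕ} {η : ℝ} (H : Regime k ℓ η) {t : ℕ} (ht : t ≤ ℓ) :
    1 / 2 ≤ ∏ i ∈ Finset.range t, (1 - sampleCap k ℓ i) := by
  have hℓ : (0 : ℝ) < ℓ := by have := H.three_le; exact_mod_cast (by omega : 0 < ℓ)
  -- The upper bound 1 is carried along because the inductive step multiplies the partial product by
  -- the new cap.
  have key : ∀ u ≤ ℓ, 1 - (u : ℝ) * (1 / (2 * ℓ)) ≤ ∏ i ∈ Finset.range u, (1 - sampleCap k ℓ i) ∧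
      ∏ i ∈ Finset.range u, (1 - sampleCap k ℓ i) ≤ 1 := by
    intro u hu
    induction u with
    | zero => simp
    | succ u ih =>
      obtain ⟨h1, h2⟩ := ih (by omega)
      rw [Finset.prod_range_succ]
      have h3 : sampleCap k ℓ u ≤ 1 / (2 * ℓ) := by
        rw [le_div_iff₀ (by positivity)]
        linarith [H.mul_sampleCap_le u]
      have h4 := sampleCap_nonneg (k := k) (ℓ := ℓ) (by linarith [H.one_le_log]) u
      have h5 : 0 ≤ ∏ i ∈ Finset.range u, (1 - sampleCap k ℓ i) :=
        Finset.prod_nonneg fun i _ => by linarith [H.sampleCap_le_one i]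
      push_cast
      constructor <;> nlinarith
  have htℓ : (t : ℝ) ≤ ℓ := by exact_mod_cast ht
  have h6 : (t : ℝ) * (1 / (2 * ℓ)) ≤ 1 / 2 := by
    rw [mul_one_div, div_le_div_iff₀ (by positivity) (by norm_num)]
    linarith
  linarith [(key t ht).1]

variable {k ℓ : ℕ}

theorem card_levelPart_univ {j : ℕ} (hj : j < ℓ) :
    (levelPart (Finset.univ : Finset (HardVertex k ℓ)) j).card = k := by
  have : levelPart (Finset.univ : Finset (HardVertex k ℓ)) j =
      (Finset.univ : Finset (Fin k)).map ⟨fun x => ((⟨j, hj⟩ : Fin ℓ), x), fun x y h => by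
        simpa using h⟩ := by
    ext ⟨a, x⟩
    rw [mem_levelPart, Finset.mem_map]
    constructor
    · rintro ⟨-, h⟩
      exact ⟨x, Finset.mem_univ _, Prod.ext (Fin.ext h.symm) rfl⟩
    · rintro ⟨y, -, h⟩
      exact ⟨Finset.mem_univ _, (congrArg (fun z : HardVertex k ℓ => (z.1 : ℕ)) h).symm⟩
  rw [this]
  simp

/-- The random edges of `R` join different levels, and no vertex has more than twice the expected
number of neighbours in another level. -/
def BoundedDegrees (R : Finset (HardVertex k ℓ × HardVertex k ℓ)) : Prop :=
  (∀ e ∈ R, e.1.1 < e.2.1) ∧ ∀ u : HardVertex k ℓ, ∀ b < ℓ, b ≠ u.1 →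
    ((levelPart (remNbrs (layeredGraph k ℓ R) Finset.univ u) b).card : ℝ) ≤
      2 * (k * crossProb k ℓ (min (u.1 : ℕ) b))

/-- No iteration samples more than twice the maximal expected number of vertices of a level. -/
def BoundedSamples (h : ℕ → Finset (HardVertex k ℓ)) (t : ℕ) : Prop :=
  ∀ i < t, ∀ a < ℓ, ((levelPart (h i) a).card : ℝ) ≤ 2 * (k * sampleCap k ℓ i)

/-- Inside a block of consecutive indices, residues modulo the block size are distinct. -/
theorem card_sameCluster_le (u : HardVertex k ℓ) (hc : 0 < clusterSize k u.1)
    (A : Finset (HardVertex k ℓ)) (hA : ∀ w ∈ A, SameCluster u w) :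
    A.card ≤ clusterSize k u.1 := by
  set c := clusterSize k u.1 with hcdef
  have hA' : ∀ w ∈ A, (w.1 : ℕ) = u.1 ∧ (w.2 : ℕ) / c = (u.2 : ℕ) / c := fun w hw => by
    obtain ⟨h1, h2⟩ := hA w hw
    rw [← h1] at h2
    exact ⟨by rw [h1], h2.symm⟩
  have hinj : Set.InjOn (fun w : HardVertex k ℓ => (w.2 : ℕ) % c)
      (A : Set (HardVertex k ℓ)) := by
    intro w hw w' hw' heq
    obtain ⟨h1, h2⟩ := hA' w hw
    obtain ⟨h1', h2'⟩ := hA' w' hw'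
    refine Prod.ext (Fin.ext (h1.trans h1'.symm)) (Fin.ext ?_)
    rw [← Nat.div_add_mod (w.2 : ℕ) c, ← Nat.div_add_mod (w'.2 : ℕ) c, h2, h2']
    exact congrArg _ heq
  have := Finset.card_le_card_of_injOn (t := Finset.range c) _
    (fun w _ => by simpa using Nat.mod_lt _ hc) hinj
  simpa using this

/-- Clusters are cliques, so block numbers are distinct on an independent set; the + 1 allows for an
incomplete last block. -/
theorem card_levelPart_le_of_indep {R : Finset (HardVertex k ℓ × HardVertex k ℓ)}
    {S : Finset (HardVertex k ℓ)}
    (hS : ∀ u ∈ S, ∀ w ∈ S, ¬ (layeredGraph k ℓ R).Adj u w) (a : ℕ) :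
    (levelPart S a).card ≤ k / clusterSize k a + 1 := by
  have hinj : Set.InjOn (fun w : HardVertex k ℓ => (w.2 : ℕ) / clusterSize k a)
      (levelPart S a : Set (HardVertex k ℓ)) := by
    intro u hu w hw heq
    obtain ⟨h1, h2⟩ := mem_levelPart.1 hu
    obtain ⟨h1', h2'⟩ := mem_levelPart.1 hw
    by_contra hne
    refine hS u h1 w h1' ⟨hne, Or.inl ⟨Fin.ext (h2.trans h2'.symm), ?_⟩⟩
    rw [h2, h2']
    exact heq
  have := Finset.card_le_card_of_injOn (t := Finset.range (k / clusterSize k a + 1)) _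
    (fun w _ => by
      simp only [Finset.coe_range, Set.mem_Iio]
      exact Nat.lt_succ_of_le (Nat.div_le_div_right w.2.2.le)) hinj
  simpa using this

/-- The number of vertices of level `j` that a single vertex `u` covers. -/
theorem card_covered_singleton_le {η : ℝ} (H : Regime k ℓ η)
    {R : Finset (HardVertex k ℓ × HardVertex k ℓ)} (hR : BoundedDegrees R) (u : HardVertex k ℓ)
    {j : ℕ} (hj : j < ℓ) :
    ((levelPart (coveredBy (layeredGraph k ℓ R) {u}) j).card : ℝ) ≤
      if (u.1 : ℕ) = j then realSize k j else 2 * (k * crossProb k ℓ (min (u.1 : ℕ) j)) := by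
  split_ifs with h
  · have hc : 0 < clusterSize k u.1 := Nat.floor_pos.2 (one_le_realSize H.one_le_k u.1)
    have hle := card_sameCluster_le u hc
      (levelPart (coveredBy (layeredGraph k ℓ R) {u}) j) fun w hw => by
        obtain ⟨h1, h2⟩ := mem_levelPart.1 hw
        have hlev : u.1 = w.1 := Fin.ext (h.trans h2.symm)
        simp only [coveredBy, Finset.mem_filter, Finset.mem_univ, true_and,
          Finset.mem_singleton, exists_eq_left] at h1
        rcases h1 with rfl | ⟨-, h1 | h1 | h1⟩
        · exact ⟨rfl, rfl⟩
        · exact h1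
        · exact absurd hlev (hR.1 _ h1).ne
        · exact absurd hlev.symm (hR.1 _ h1).ne
    refine le_trans (Nat.cast_le.2 hle) ?_
    rw [h]
    exact Nat.floor_le (rpow_nonneg (by positivity) _)
  · refine le_trans (Nat.cast_le.2 (Finset.card_le_card ?_)) (hR.2 u j hj (Ne.symm h))
    intro w hw
    obtain ⟨h1, h2⟩ := mem_levelPart.1 hw
    simp only [coveredBy, Finset.mem_filter, Finset.mem_univ, true_and,
      Finset.mem_singleton, exists_eq_left] at h1
    refine mem_levelPart.2 ⟨mem_remNbrs.2 ⟨Finset.mem_univ _, ?_⟩, h2⟩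
    rcases h1 with rfl | h1
    · exact absurd h2 h
    · exact h1

theorem card_levelPart_coveredBy_le {G : SimpleGraph (HardVertex k ℓ)}
    (S : Finset (HardVertex k ℓ)) (j : ℕ) {M : ℕ → ℝ} {x : ℝ}
    (hcov : ∀ u ∈ S, ((levelPart (coveredBy G {u}) j).card : ℝ) ≤ M u.1)
    (hx : ∀ a < ℓ, (levelPart S a).card * M a ≤ x) :
    ((levelPart (coveredBy G S) j).card : ℝ) ≤ ℓ * x := by
  have hsub : levelPart (coveredBy G S) j ⊆
      S.biUnion fun u => levelPart (coveredBy G {u}) j := by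
    intro w hw
    obtain ⟨h1, h2⟩ := mem_levelPart.1 hw
    simp only [coveredBy, Finset.mem_filter, Finset.mem_univ, true_and] at h1
    simp only [Finset.mem_biUnion, mem_levelPart, coveredBy, Finset.mem_filter,
      Finset.mem_univ, true_and, Finset.mem_singleton, exists_eq_left]
    rcases h1 with h1 | ⟨s, hs, h1⟩
    · exact ⟨w, h1, Or.inl rfl, h2⟩
    · exact ⟨s, hs, Or.inr h1, h2⟩
  calc ((levelPart (coveredBy G S) j).card : ℝ)
      ≤ ((∑ u ∈ S, (levelPart (coveredBy G {u}) j).card : ℕ) : ℝ) :=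
        Nat.cast_le.2 ((Finset.card_le_card hsub).trans Finset.card_biUnion_le)
    _ ≤ ∑ u ∈ S, M u.1 := by
        rw [Nat.cast_sum]
        exact Finset.sum_le_sum hcov
    _ = ∑ a : Fin ℓ, ∑ u ∈ S with u.1 = a, M u.1 := (Finset.sum_fiberwise S (fun u => u.1) _).symm
    _ = ∑ a : Fin ℓ, (levelPart S a).card * M a := by
        refine Finset.sum_congr rfl fun a _ => ?_
        have : (S.filter fun u => u.1 = a) = levelPart S a := by
          ext u
          simp [mem_levelPart, Fin.ext_iff]
        rw [this, ← nsmul_eq_mul, ← Finset.sum_const]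
        exact Finset.sum_congr rfl fun u hu => by rw [(mem_levelPart.1 hu).2]
    _ ≤ ∑ _a : Fin ℓ, x := Finset.sum_le_sum fun a _ => hx a a.2
    _ = ℓ * x := by simp

/-- Each iteration `i` covers only a small part of every level above level `i`. -/
theorem card_newly_covered_le {η : ℝ} (H : Regime k ℓ η)
    {R : Finset (HardVertex k ℓ × HardVertex k ℓ)} (hR : BoundedDegrees R)
    (ord : ℕ → Fin (Fintype.card (HardVertex k ℓ)) ≃ HardVertex k ℓ)
    {h : ℕ → Finset (HardVertex k ℓ)} {t : ℕ} (hh : BoundedSamples h t) {i j : ℕ} (hi : i < t)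
    (hij : i < j) (hj : j < ℓ) :
    ((levelPart (coveredBy (layeredGraph k ℓ R)
      (lfmis (layeredGraph k ℓ R) (ord i) (h i))) j).card : ℝ) ≤
        ℓ * (6 * k / logSize k ℓ ^ 2) := by
  have hk := H.one_le_k
  have hk' : (1 : ℝ) ≤ k := by exact_mod_cast hk
  have hL := H.one_le_log
  set L := logSize k ℓ with hLdef
  refine card_levelPart_coveredBy_le (M := fun a => if a = j then realSize k j else
    2 * (k * crossProb k ℓ (min a j))) _ j (fun u _ => ?_) (fun a ha => ?_)
  · exact card_covered_singleton_le H hR u hj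
  · simp only [mul_crossProb hk]
    rw [← hLdef]
    -- Levels up to i are controlled by independence, levels above i by the small number of samples.
    rcases le_or_gt a i with hai | hai
    · have hs := one_le_realSize hk a
      rw [if_neg (by omega), min_eq_left (by omega)]
      have hcard := card_levelPart_le_of_indep (lfmis_indep (layeredGraph k ℓ R) (ord i) (h i)) a
      -- Rounding down a number that is at least 1 loses at most a factor 2.
      have hfl : realSize k a / 2 ≤ clusterSize k a := by
        have h1 := Nat.lt_floor_add_one (realSize k a)
        have h2 : (1 : ℝ) ≤ (⌊realSize k a⌋₊ : ℝ) := by exact_mod_cast Nat.floor_pos.2 hs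
        change realSize k a / 2 ≤ (⌊realSize k a⌋₊ : ℝ)
        linarith
      have hcard' : ((levelPart (lfmis (layeredGraph k ℓ R) (ord i) (h i)) a).card : ℝ) ≤
          2 * k / realSize k a + 1 := by
        refine (Nat.cast_le.2 hcard).trans ?_
        push_cast
        have h1 : ((k / clusterSize k a : ℕ) : ℝ) ≤ (k : ℝ) / clusterSize k a := Nat.cast_div_le
        have h2 : (k : ℝ) / clusterSize k a ≤ k / (realSize k a / 2) :=
          div_le_div_of_nonneg_left (by positivity) (by positivity) hfl
        have h3 : (k : ℝ) / (realSize k a / 2) = 2 * k / realSize k a := by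
          field_simp
        linarith
      refine (mul_le_mul_of_nonneg_right hcard' (by positivity)).trans ?_
      rw [mul_div_assoc', mul_div_assoc']
      refine div_le_div_of_nonneg_right ?_ (sq_nonneg L)
      -- The constant 6 comes from here: 4k + 2 s_a ≤ 6k.
      have h1 : (2 * k / realSize k a + 1) * (2 * realSize k a) = 4 * k + 2 * realSize k a := by
        field_simp
        ring
      rw [h1]
      linarith [realSize_le hk a]
    · have hs := one_le_realSize hk (i + 1)
      have hsz := H.size (i + 1) (by omega)
      rw [← hLdef] at hsz
      have hcard : ((levelPart (lfmis (layeredGraph k ℓ R) (ord i) (h i)) a).card : ℝ) ≤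
          2 * (k * (4 * L / realSize k (i + 1) ^ 2)) := by
        have h1 := hh i hi a ha
        have h2 : √(realSize k i) = realSize k (i + 1) ^ 2 := by
          rw [realSize_succ, show realSize k (i + 1) ^ 4 = (realSize k (i + 1) ^ 2) ^ 2 by ring]
          exact sqrt_sq (by positivity)
        rw [sampleCap, if_pos (by omega), h2] at h1
        refine le_trans (Nat.cast_le.2 (Finset.card_le_card ?_)) h1
        exact Finset.filter_subset_filter _ (lfmis_subset _ _ _)
      -- Both a and j are at least i + 1, so a vertex covers its cluster or at most 2 s_{i+1}/L²
      -- vertices of level j.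
      have hM : (if a = j then realSize k j else 2 * (realSize k (min a j) / L ^ 2)) ≤
          2 * realSize k (i + 1) := by
        split_ifs
        · linarith [realSize_antitone hk (show i + 1 ≤ j by omega), one_le_realSize hk j]
        · have h1 := realSize_antitone hk (show i + 1 ≤ min a j by omega)
          have h2 : realSize k (min a j) / L ^ 2 ≤ realSize k (min a j) :=
            div_le_self (by linarith [one_le_realSize hk (min a j)]) (one_le_pow₀ hL)
          linarith
      refine (mul_le_mul hcard hM ?_ (by positivity)).trans ?_
      · split_ifs
        · linarith [one_le_realSize hk j]
        · have := one_le_realSize hk (min a j)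
          positivity
      · have h1 : 2 * (k * (4 * L / realSize k (i + 1) ^ 2)) * (2 * realSize k (i + 1)) =
            16 * k * L / realSize k (i + 1) := by
          field_simp
          ring
        rw [h1, div_le_div_iff₀ (by positivity) (by positivity)]
        have h3 : (3 : ℝ) ≤ ℓ := by exact_mod_cast H.three_le
        have h4 : 64 * L ^ 3 ≤ realSize k (i + 1) := by
          refine le_trans ?_ hsz
          refine mul_le_mul_of_nonneg_right ?_ (by positivity)
          nlinarith
        nlinarith [mul_le_mul_of_nonneg_left h4 (by positivity : (0 : ℝ) ≤ k), pow_pos (by linarith : 0 < L) 3]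

/-- Most of every level that is not yet processed survives. -/
theorem le_card_levelPart_alive {η : ℝ} (H : Regime k ℓ η)
    {R : Finset (HardVertex k ℓ × HardVertex k ℓ)} (hR : BoundedDegrees R)
    (ord : ℕ → Fin (Fintype.card (HardVertex k ℓ)) ≃ HardVertex k ℓ)
    {h : ℕ → Finset (HardVertex k ℓ)} {t : ℕ} (hh : BoundedSamples h t) {j : ℕ}
    (htj : t ≤ j) (hj : j < ℓ) :
    (k : ℝ) * (1 - 10 * ℓ * t / logSize k ℓ ^ 2) ≤
      (levelPart (alive (layeredGraph k ℓ R) ord h t) j).card := by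
  -- Since t ≤ j, every iteration i < t has i < j, as the bound per iteration requires.
  have key : ∀ i ≤ t, (k : ℝ) - i * (ℓ * (6 * k / logSize k ℓ ^ 2)) ≤
      (levelPart (alive (layeredGraph k ℓ R) ord h i) j).card := by
    intro i hi
    induction i with
    | zero => simp [alive, card_levelPart_univ hj]
    | succ i ih =>
      have h1 := ih (by omega)
      have h2 := card_newly_covered_le H hR ord hh (i := i) (j := j) (by omega) (by omega) hj
      have h3 : levelPart (alive (layeredGraph k ℓ R) ord h i) j ⊆
          levelPart (alive (layeredGraph k ℓ R) ord h (i + 1)) j ∪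
          levelPart (coveredBy (layeredGraph k ℓ R)
            (lfmis (layeredGraph k ℓ R) (ord i) (h i))) j := by
        intro w hw
        obtain ⟨h4, h5⟩ := mem_levelPart.1 hw
        rw [Finset.mem_union, mem_levelPart, mem_levelPart, alive, Finset.mem_sdiff]
        tauto
      have h4 := (Finset.card_le_card h3).trans (Finset.card_union_le _ _)
      have h5 : ((levelPart (alive (layeredGraph k ℓ R) ord h i) j).card : ℝ) ≤
          (levelPart (alive (layeredGraph k ℓ R) ord h (i + 1)) j).card +
          (levelPart (coveredBy (layeredGraph k ℓ R)
            (lfmis (layeredGraph k ℓ R) (ord i) (h i))) j).card := by exact_mod_cast h4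
      push_cast
      linarith
  refine le_trans ?_ (key t le_rfl)
  have : (0 : ℝ) ≤ ℓ * t * k / logSize k ℓ ^ 2 := by positivity
  have h1 : (k : ℝ) * (1 - 10 * ℓ * t / logSize k ℓ ^ 2) =
      k - 10 * (ℓ * t * k / logSize k ℓ ^ 2) := by ring
  have h2 : (t : ℝ) * (ℓ * (6 * k / logSize k ℓ ^ 2)) =
      6 * (ℓ * t * k / logSize k ℓ ^ 2) := by ring
  rw [h1, h2]
  linarith

end SizeBounds

/-! ### Failure probabilities under a capped local rule. -/

section ModelBounds

variable {k ℓ : ℕ}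

open Classical in
/-- The indicator of a proposition. -/
noncomputable def ind (p : Prop) : ℝ := if p then 1 else 0

theorem ind_of {p : Prop} (h : p) : ind p = 1 := if_pos h

theorem ind_of_not {p : Prop} (h : ¬ p) : ind p = 0 := if_neg h

theorem ind_nonneg (p : Prop) : 0 ≤ ind p := by
  unfold ind
  split_ifs <;> norm_num

theorem ind_mono {p q : Prop} (h : p → q) : ind p ≤ ind q := by
  by_cases hp : p
  · rw [ind_of hp, ind_of (h hp)]
  · rw [ind_of_not hp]
    exact ind_nonneg q

theorem ind_or_le (p q : Prop) : ind (p ∨ q) ≤ ind p + ind q := by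
  by_cases hp : p
  · rw [ind_of hp, ind_of (Or.inl hp)]
    linarith [ind_nonneg q]
  · rw [ind_of_not hp, zero_add]
    exact ind_mono fun h => h.resolve_left hp

theorem ind_exists_le {ι : Type*} [Fintype ι] (p : ι → Prop) :
    ind (∃ i, p i) ≤ ∑ i, ind (p i) := by
  by_cases h : ∃ i, p i
  · obtain ⟨i, hi⟩ := h
    rw [ind_of ⟨i, hi⟩, ← ind_of hi]
    exact Finset.single_le_sum (f := fun i => ind (p i)) (fun _ _ => ind_nonneg _)
      (Finset.mem_univ i)
  · rw [ind_of_not h]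
    exact Finset.sum_nonneg fun _ _ => ind_nonneg _

/-- The probability of the set `R` of random edges. -/
noncomputable def edgeWeight (R : Finset (HardVertex k ℓ × HardVertex k ℓ)) : ℝ :=
  subsetWeight (fun e => (pairProb k ℓ e : ℝ)) R

theorem edgeWeight_nonneg (R : Finset (HardVertex k ℓ × HardVertex k ℓ)) : 0 ≤ edgeWeight R :=
  subsetWeight_nonneg (fun e => (pairProb k ℓ e).2.1) (fun e => (pairProb k ℓ e).2.2) R

theorem sum_edgeWeight :
    ∑ R : Finset (HardVertex k ℓ × HardVertex k ℓ), edgeWeight R = 1 :=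
  sum_subsetWeight _

theorem lt_of_edgeWeight_ne_zero {R : Finset (HardVertex k ℓ × HardVertex k ℓ)}
    (hR : edgeWeight R ≠ 0) : ∀ e ∈ R, e.1.1 < e.2.1 := by
  intro e he
  by_contra hlt
  refine hR (Finset.prod_eq_zero (Finset.mem_univ e) ?_)
  have h0 : pairProb k ℓ e = 0 := if_neg hlt
  simp [he, h0]

theorem sum_subsetWeight_ind_upper_tail {α : Type*} [Fintype α] [DecidableEq α] {p : α → ℝ}
    (h0 : ∀ a, 0 ≤ p a) (h1 : ∀ a, p a ≤ 1) (T : Finset α) {c η : ℝ} (hc : 0 ≤ c)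
    (hp : ∀ a ∈ T, p a ≤ c) (hη : η ≤ T.card * c / 4) :
    ∑ F, subsetWeight p F * ind (¬ ((F ∩ T).card : ℝ) ≤ 2 * (T.card * c)) ≤ exp (-η) := by
  refine le_trans (le_of_eq ?_) ((sum_subsetWeight_upper_tail h0 h1 T hc hp).trans
    (exp_le_exp.2 (by linarith)))
  refine Finset.sum_congr rfl fun F _ => ?_
  congr 1
  split_ifs with h
  · exact ind_of_not (not_not.2 h)
  · exact ind_of h

/-- A union bound over a vertex and another level, with the upper tail for the k independent pairs
between them. Pairs in the wrong orientation have probability 0. -/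
theorem sum_not_boundedDegrees_le {η : ℝ} (H : Regime k ℓ η) :
    ∑ R : Finset (HardVertex k ℓ × HardVertex k ℓ), edgeWeight R * ind (¬ BoundedDegrees R) ≤
      k * ℓ * ℓ * exp (-η) := by
  classical
  have hL := H.one_le_log
  set T : HardVertex k ℓ → ℕ → Finset (HardVertex k ℓ × HardVertex k ℓ) := fun u b =>
    (levelPart Finset.univ b).image (orientedPair u) with hT
  have hne : ∀ u : HardVertex k ℓ, ∀ b : ℕ, b ≠ u.1 →
      ∀ w ∈ levelPart (Finset.univ : Finset (HardVertex k ℓ)) b, w.1 ≠ u.1 :=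
    fun u b hb w hw h' => hb (by rw [← (mem_levelPart.1 hw).2, h'])
  have hTcard : ∀ u : HardVertex k ℓ, ∀ b < ℓ, b ≠ u.1 → (T u b).card = k := by
    intro u b hb hbu
    rw [hT]
    dsimp only
    rw [Finset.card_image_of_injOn, card_levelPart_univ hb]
    intro w hw w' hw' heq
    rw [← otherEnd_orientedPair (hne u b hbu w hw), heq,
      otherEnd_orientedPair (hne u b hbu w' hw')]
  set Bad : HardVertex k ℓ → Fin ℓ → Finset (HardVertex k ℓ × HardVertex k ℓ) → Prop :=
    fun u b R => (b : ℕ) ≠ u.1 ∧ ¬ ((R ∩ T u b).card : ℝ) ≤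
      2 * (k * crossProb k ℓ (min (u.1 : ℕ) b)) with hBad
  have hpt : ∀ R, edgeWeight R * ind (¬ BoundedDegrees R) ≤
      ∑ x : HardVertex k ℓ × Fin ℓ, edgeWeight R * ind (Bad x.1 x.2 R) := by
    intro R
    by_cases hR : edgeWeight R = 0
    · simp [hR]
    rw [← Finset.mul_sum]
    refine mul_le_mul_of_nonneg_left ?_ (edgeWeight_nonneg R)
    refine le_trans (ind_mono fun hnot => ?_) (ind_exists_le _)
    have hlt := lt_of_edgeWeight_ne_zero hR
    by_contra hex
    refine hnot ⟨hlt, fun u b hb hbu => ?_⟩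
    have h1 : ((R ∩ T u b).card : ℝ) ≤ 2 * (k * crossProb k ℓ (min (u.1 : ℕ) b)) := by
      by_contra h'
      exact hex ⟨(u, ⟨b, hb⟩), hbu, h'⟩
    refine le_trans (Nat.cast_le.2 ?_) h1
    rw [← Finset.card_image_of_injOn (f := orientedPair u)
      (s := levelPart (remNbrs (layeredGraph k ℓ R) Finset.univ u) b)]
    · refine Finset.card_le_card fun e he => ?_
      obtain ⟨w, hw, rfl⟩ := Finset.mem_image.1 he
      obtain ⟨h2, h3⟩ := mem_levelPart.1 hw
      have hadj := (mem_remNbrs.1 h2).2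
      have hwb : w ∈ levelPart (Finset.univ : Finset (HardVertex k ℓ)) b :=
        mem_levelPart.2 ⟨Finset.mem_univ _, h3⟩
      refine Finset.mem_inter.2 ⟨?_, Finset.mem_image_of_mem _ hwb⟩
      unfold orientedPair
      rcases hadj.2 with h4 | h4 | h4
      · exact absurd h4.1.symm (hne u b hbu w hwb)
      · rwa [if_pos (hlt _ h4)]
      · rwa [if_neg (not_lt.2 (hlt _ h4).le)]
    · intro w hw w' hw' heq
      have hm : ∀ w ∈ levelPart (remNbrs (layeredGraph k ℓ R) Finset.univ u) b, w.1 ≠ u.1 :=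
        fun w hw => hne u b hbu w (mem_levelPart.2 ⟨Finset.mem_univ _, (mem_levelPart.1 hw).2⟩)
      rw [← otherEnd_orientedPair (hm w hw), heq, otherEnd_orientedPair (hm w' hw')]
  refine (Finset.sum_le_sum fun R _ => hpt R).trans ?_
  rw [Finset.sum_comm]
  have hx : ∀ x : HardVertex k ℓ × Fin ℓ,
      ∑ R, edgeWeight R * ind (Bad x.1 x.2 R) ≤ exp (-η) := by
    rintro ⟨u, b⟩
    by_cases hbu : (b : ℕ) = u.1
    · have h0 : ∀ R, ind (Bad u b R) = 0 := fun R => ind_of_not fun h => h.1 hbu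
      simp only [h0, mul_zero, Finset.sum_const_zero]
      positivity
    have hc := hTcard u b b.2 hbu
    have htail := sum_subsetWeight_ind_upper_tail
      (p := fun e : HardVertex k ℓ × HardVertex k ℓ => (pairProb k ℓ e : ℝ))
      (fun e => (pairProb k ℓ e).2.1) (fun e => (pairProb k ℓ e).2.2) (T u b)
      (c := crossProb k ℓ (min (u.1 : ℕ) b)) (η := η) (crossProb_mem k ℓ _).1
      (fun e he => by
        obtain ⟨w, hw, rfl⟩ := Finset.mem_image.1 he
        rw [pairProb_orientedPair (hne u b hbu w hw), (mem_levelPart.1 hw).2])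
      (by
        rw [hc, mul_crossProb H.one_le_k, le_div_iff₀ (by norm_num), le_div_iff₀ (by positivity)]
        have := H.exponent (min (u.1 : ℕ) b) (min_lt_of_left_lt u.1.2)
        nlinarith [H.exponent_nonneg, mul_nonneg (sq_nonneg (logSize k ℓ)) H.exponent_nonneg])
    rw [hc] at htail
    refine le_trans (Finset.sum_le_sum fun R _ => ?_) htail
    exact mul_le_mul_of_nonneg_left (ind_mono fun h => h.2) (edgeWeight_nonneg R)
  refine (Finset.sum_le_sum fun x _ => hx x).trans (le_of_eq ?_)
  simp only [Finset.sum_const, Finset.card_univ, Fintype.card_prod, Fintype.card_fin, nsmul_eq_mul]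
  push_cast
  ring

/-- Since s_i ≤ k, the capped mean sample of a level has at least order √k elements, enough for the
Chernoff exponent η. -/
theorem Regime.le_mul_sampleCap {η : ℝ} (H : Regime k ℓ η) {i : ℕ} (hi : i < ℓ) :
    η ≤ k * sampleCap k ℓ i / 4 := by
  have hk : (1 : ℝ) ≤ k := by exact_mod_cast H.one_le_k
  have hL := H.one_le_log
  rw [sampleCap, if_pos hi]
  have h1 : √(realSize k i) ≤ √k := sqrt_le_sqrt (realSize_le H.one_le_k i)
  have h2 : 0 < √(realSize k i) := sqrt_pos.2 (by linarith [one_le_realSize H.one_le_k i])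
  have h3 : k * (4 * logSize k ℓ / √(realSize k i)) / 4 =
      k * logSize k ℓ / √(realSize k i) := by ring
  rw [h3, le_div_iff₀ h2]
  have h4 : √(k : ℝ) * √k = k := mul_self_sqrt (by positivity)
  calc η * √(realSize k i) ≤ √k * √k :=
        mul_le_mul H.exponent_le_sqrt h1 h2.le (sqrt_nonneg _)
    _ = k * 1 := by rw [h4, mul_one]
    _ ≤ _ := mul_le_mul_of_nonneg_left hL (by positivity)

/-- Given the past, the samples of an iteration are independent with probabilities below the cap;
each iteration adds one Chernoff failure per level. -/
theorem pathSum_not_boundedSamples_le {η : ℝ} (H : Regime k ℓ η)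
    (G : SimpleGraph (HardVertex k ℓ))
    (ord : ℕ → Fin (Fintype.card (HardVertex k ℓ)) ≃ HardVertex k ℓ)
    {P : ℕ → Finset (HardVertex k ℓ) → HardVertex k ℓ → ℝ} (h0 : ∀ i A v, 0 ≤ P i A v)
    (hP : ∀ i A v, P i A v ≤ sampleCap k ℓ i) {t : ℕ} (ht : t ≤ ℓ) :
    pathSum t (fun h => sampleWeight G ord P h t * ind (¬ BoundedSamples h t)) ≤
      t * ℓ * exp (-η) := by
  have hL := H.one_le_log
  have h1 : ∀ i A v, P i A v ≤ 1 := fun i A v => (hP i A v).trans (H.sampleCap_le_one i)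
  induction t with
  | zero =>
    have : ∀ h : ℕ → Finset (HardVertex k ℓ), ind (¬ BoundedSamples h 0) = 0 := fun h =>
      ind_of_not fun hn => hn fun i hi => absurd hi (by omega)
    simp [pathSum, this]
  | succ t ih =>
    rw [pathSum_sampleWeight_succ]
    have hstep : ∀ h : ℕ → Finset (HardVertex k ℓ),
        ∑ S, subsetWeight (P t (alive G ord h t)) S *
          ind (¬ BoundedSamples (Function.update h t S) (t + 1)) ≤
        ind (¬ BoundedSamples h t) + ℓ * exp (-η) := by
      intro h
      have hw := subsetWeight_nonneg (h0 t (alive G ord h t)) (h1 t (alive G ord h t))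
      have hpt : ∀ S, subsetWeight (P t (alive G ord h t)) S *
          ind (¬ BoundedSamples (Function.update h t S) (t + 1)) ≤
          subsetWeight (P t (alive G ord h t)) S * ind (¬ BoundedSamples h t) +
          ∑ a : Fin ℓ, subsetWeight (P t (alive G ord h t)) S *
            ind (¬ ((S ∩ levelPart Finset.univ a).card : ℝ) ≤ 2 * (k * sampleCap k ℓ t)) := by
        intro S
        rw [← Finset.mul_sum, ← mul_add]
        refine mul_le_mul_of_nonneg_left ?_ (hw S)
        refine le_trans (ind_mono fun hn => ?_)
          ((ind_or_le _ _).trans (add_le_add le_rfl (ind_exists_le _)))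
        by_contra hcon
        push Not at hcon
        refine hn fun i hi a ha => ?_
        rcases Nat.lt_succ_iff_lt_or_eq.1 hi with hlt | rfl
        · rw [Function.update_of_ne hlt.ne]
          exact hcon.1 i hlt a ha
        · rw [Function.update_self]
          have hS : levelPart S a = S ∩ levelPart Finset.univ a := by
            ext v
            simp [mem_levelPart]
          rw [hS]
          exact hcon.2 ⟨a, ha⟩
      refine (Finset.sum_le_sum fun S _ => hpt S).trans ?_
      rw [Finset.sum_add_distrib, ← Finset.sum_mul, sum_subsetWeight, one_mul, Finset.sum_comm]
      refine add_le_add le_rfl ?_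
      have htail : ∀ a : Fin ℓ, ∑ S, subsetWeight (P t (alive G ord h t)) S *
          ind (¬ ((S ∩ levelPart Finset.univ a).card : ℝ) ≤ 2 * (k * sampleCap k ℓ t)) ≤
          exp (-η) := by
        intro a
        have hc := card_levelPart_univ (k := k) a.2
        have := sum_subsetWeight_ind_upper_tail (h0 t (alive G ord h t))
          (h1 t (alive G ord h t)) (levelPart Finset.univ (a : ℕ)) (η := η)
          (sampleCap_nonneg (by linarith) t)
          (fun v _ => hP t (alive G ord h t) v) (by rw [hc]; exact H.le_mul_sampleCap (by omega))
        rwa [hc] at this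
      refine (Finset.sum_le_sum fun a _ => htail a).trans (le_of_eq ?_)
      simp
    refine (pathSum_mono t fun h => mul_le_mul_of_nonneg_left (hstep h)
      (sampleWeight_nonneg h0 h1 h t)).trans ?_
    simp only [mul_add]
    rw [pathSum_add]
    have h2 : pathSum t (fun h => sampleWeight G ord P h t * (ℓ * exp (-η))) = ℓ * exp (-η) := by
      simp only [mul_comm _ ((ℓ : ℝ) * exp (-η))]
      rw [pathSum_mul_left, pathSum_sampleWeight, mul_one]
    rw [h2]
    push_cast
    linarith [ih (by omega)]

/-- The levels from `t` on keep most of their vertices in the first `t` iterations. -/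
def LevelsSurvive (ord : ℕ → Fin (Fintype.card (HardVertex k ℓ)) ≃ HardVertex k ℓ)
    (R : Finset (HardVertex k ℓ × HardVertex k ℓ)) (h : ℕ → Finset (HardVertex k ℓ))
    (t : ℕ) : Prop :=
  ∀ j, t ≤ j → j < ℓ → (k : ℝ) * (1 - 10 * ℓ * t / logSize k ℓ ^ 2) ≤
    (levelPart (alive (layeredGraph k ℓ R) ord h t) j).card

/-- The degrees in the graph that remains after `t` iterations are not too small. -/
def DegreesLarge (ord : ℕ → Fin (Fintype.card (HardVertex k ℓ)) ≃ HardVertex k ℓ)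
    (R : Finset (HardVertex k ℓ × HardVertex k ℓ)) (h : ℕ → Finset (HardVertex k ℓ))
    (t : ℕ) : Prop :=
  ∀ v ∈ alive (layeredGraph k ℓ R) ord h t, realSize k t / (16 * logSize k ℓ ^ 2) ≤
    (remNbrs (layeredGraph k ℓ R) (alive (layeredGraph k ℓ R) ord h t) v).card

/-- The probability of an event, for a random graph and random sampled sets. -/
noncomputable def eventProb
    (ord : ℕ → Fin (Fintype.card (HardVertex k ℓ)) ≃ HardVertex k ℓ)
    (P : SimpleGraph (HardVertex k ℓ) → ℕ → Finset (HardVertex k ℓ) → HardVertex k ℓ → ℝ)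
    (t : ℕ) (Z : Finset (HardVertex k ℓ × HardVertex k ℓ) → (ℕ → Finset (HardVertex k ℓ)) → Prop) :
    ℝ :=
  ∑ R, edgeWeight R * pathSum t fun h =>
    sampleWeight (layeredGraph k ℓ R) ord (P (layeredGraph k ℓ R)) h t * ind (Z R h)

variable {ord : ℕ → Fin (Fintype.card (HardVertex k ℓ)) ≃ HardVertex k ℓ}
  {ρ : ℕ → Finset (HardVertex k ℓ) → HardVertex k ℓ → Finset (HardVertex k ℓ) → ℝ}

theorem eventProb_not_levelsSurvive_le {η : ℝ} (H : Regime k ℓ η)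
    (h0 : ∀ i A v nb, 0 ≤ ρ i A v nb) (hc : ∀ i A v nb, ρ i A v nb ≤ sampleCap k ℓ i)
    {t : ℕ} (ht : t ≤ ℓ) :
    eventProb ord (localProb ρ) t (fun R h => ¬ LevelsSurvive ord R h t) ≤
      (k * ℓ * ℓ + t * ℓ) * exp (-η) := by
  have hL := H.one_le_log
  have hc0 : ∀ i, 0 ≤ sampleCap k ℓ i := sampleCap_nonneg (by linarith)
  have hP0 := localProb_nonneg h0
  have hP1 := localProb_le hc0 hc
  have hw : ∀ G : SimpleGraph (HardVertex k ℓ), ∀ h, 0 ≤ sampleWeight G ord (localProb ρ G) h t :=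
    fun G h => sampleWeight_nonneg (hP0 G)
      (fun i A v => (hP1 G i A v).trans (H.sampleCap_le_one i)) h t
  have hpt : ∀ R : Finset (HardVertex k ℓ × HardVertex k ℓ), (pathSum t fun h =>
      sampleWeight (layeredGraph k ℓ R) ord (localProb ρ (layeredGraph k ℓ R)) h t *
        ind (¬ LevelsSurvive ord R h t)) ≤ ind (¬ BoundedDegrees R) + t * ℓ * exp (-η) := by
    intro R
    refine (pathSum_mono (Ψ := fun h => ind (¬ BoundedDegrees R) *
      sampleWeight (layeredGraph k ℓ R) ord (localProb ρ (layeredGraph k ℓ R)) h t +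
      sampleWeight (layeredGraph k ℓ R) ord (localProb ρ (layeredGraph k ℓ R)) h t *
        ind (¬ BoundedSamples h t)) t fun h => ?_).trans ?_
    · rw [mul_comm (ind (¬ BoundedDegrees R)), ← mul_add]
      refine mul_le_mul_of_nonneg_left ((ind_mono fun hn => ?_).trans (ind_or_le _ _)) (hw _ h)
      by_contra hcon
      push Not at hcon
      exact hn fun j htj hj => le_card_levelPart_alive H hcon.1 ord hcon.2 htj hj
    · rw [pathSum_add, pathSum_mul_left, pathSum_sampleWeight, mul_one]
      exact add_le_add le_rfl (pathSum_not_boundedSamples_le H _ ord (hP0 _) (hP1 _) ht)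
  refine (Finset.sum_le_sum fun R _ =>
    mul_le_mul_of_nonneg_left (hpt R) (edgeWeight_nonneg R)).trans ?_
  simp only [mul_add]
  rw [Finset.sum_add_distrib, ← Finset.sum_mul, sum_edgeWeight, one_mul, add_mul]
  exact add_le_add (sum_not_boundedDegrees_le H) le_rfl

theorem eventProb_mono {P : SimpleGraph (HardVertex k ℓ) → ℕ → Finset (HardVertex k ℓ) →
      HardVertex k ℓ → ℝ} (h0 : ∀ G i A v, 0 ≤ P G i A v) (h1 : ∀ G i A v, P G i A v ≤ 1)
    {t : ℕ} {Z Z' : Finset (HardVertex k ℓ × HardVertex k ℓ) →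
      (ℕ → Finset (HardVertex k ℓ)) → Prop} (hZ : ∀ R h, Z R h → Z' R h) :
    eventProb ord P t Z ≤ eventProb ord P t Z' :=
  Finset.sum_le_sum fun R _ => mul_le_mul_of_nonneg_left (pathSum_mono t fun h =>
    mul_le_mul_of_nonneg_left (ind_mono (hZ R h)) (sampleWeight_nonneg (h0 _) (h1 _) h t))
    (edgeWeight_nonneg R)

theorem eventProb_or_le {P : SimpleGraph (HardVertex k ℓ) → ℕ → Finset (HardVertex k ℓ) →
      HardVertex k ℓ → ℝ} (h0 : ∀ G i A v, 0 ≤ P G i A v) (h1 : ∀ G i A v, P G i A v ≤ 1)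
    {t : ℕ} (Z Z' : Finset (HardVertex k ℓ × HardVertex k ℓ) →
      (ℕ → Finset (HardVertex k ℓ)) → Prop) :
    eventProb ord P t (fun R h => Z R h ∨ Z' R h) ≤
      eventProb ord P t Z + eventProb ord P t Z' := by
  unfold eventProb
  rw [← Finset.sum_add_distrib]
  refine Finset.sum_le_sum fun R _ => ?_
  rw [← mul_add, ← pathSum_add]
  refine mul_le_mul_of_nonneg_left (pathSum_mono t fun h => ?_) (edgeWeight_nonneg R)
  rw [← mul_add]
  exact mul_le_mul_of_nonneg_left (ind_or_le _ _) (sampleWeight_nonneg (h0 _) (h1 _) h t)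

theorem eventProb_exists_le {P : SimpleGraph (HardVertex k ℓ) → ℕ → Finset (HardVertex k ℓ) →
      HardVertex k ℓ → ℝ} (h0 : ∀ G i A v, 0 ≤ P G i A v) (h1 : ∀ G i A v, P G i A v ≤ 1)
    {t : ℕ} {ι : Type*} [Fintype ι] (Z : ι → Finset (HardVertex k ℓ × HardVertex k ℓ) →
      (ℕ → Finset (HardVertex k ℓ)) → Prop) :
    eventProb ord P t (fun R h => ∃ x, Z x R h) ≤ ∑ x, eventProb ord P t (Z x) := by
  unfold eventProb
  rw [Finset.sum_comm]
  refine Finset.sum_le_sum fun R _ => ?_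
  rw [← Finset.mul_sum, ← pathSum_sum]
  refine mul_le_mul_of_nonneg_left (pathSum_mono t fun h => ?_) (edgeWeight_nonneg R)
  rw [← Finset.mul_sum]
  exact mul_le_mul_of_nonneg_left (ind_exists_le _) (sampleWeight_nonneg (h0 _) (h1 _) h t)

/-- Swapping the sums puts the history outside and the edges inside, where the fixed-history
estimate applies; the total weight is then 1. -/
theorem eventProb_few_survivors_le {c : ℕ → ℝ} (hc0 : ∀ i, 0 ≤ c i) (hc1 : ∀ i, c i ≤ 1)
    (h0 : ∀ i A v nb, 0 ≤ ρ i A v nb) (hc : ∀ i A v nb, ρ i A v nb ≤ c i) {t : ℕ}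
    (hct : 1 / 2 ≤ ∏ i ∈ Finset.range t, (1 - c i))
    (v : HardVertex k ℓ) {m : ℕ} (hm : m ≠ v.1) {b D : ℝ}
    (hD : 16 * D ≤ crossProb k ℓ (min (v.1 : ℕ) m) * b) :
    eventProb ord (localProb ρ) t (fun R h => v ∈ alive (layeredGraph k ℓ R) ord h t ∧
      b ≤ (levelPart (alive (layeredGraph k ℓ R) ord h t) m).card ∧
      ((levelPart (remNbrs (layeredGraph k ℓ R) (alive (layeredGraph k ℓ R) ord h t) v)
        m).card : ℝ) < 2 * D) ≤ 2 * exp (-(crossProb k ℓ (min (v.1 : ℕ) m) * b / 8)) := by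
  classical
  set ε := 2 * exp (-(crossProb k ℓ (min (v.1 : ℕ) m) * b / 8)) with hε
  unfold eventProb
  simp only [← pathSum_mul_left]
  rw [← pathSum_sum]
  refine (pathSum_mono t fun h => (le_of_eq ?_).trans
    (sum_few_survivors_le ord ρ hc0 hc1 h0 hc hct h v hm hD)).trans ?_
  · refine Finset.sum_congr rfl fun R _ => ?_
    unfold ind edgeWeight
    congr
  · rw [pathSum_sum, ← hε]
    simp only [pathSum_mul_left, pathSum_sampleWeight, mul_one]
    rw [← Finset.mul_sum, sum_subsetWeight, mul_one]

theorem Regime.ten_mul_le {η : ℝ} (H : Regime k ℓ η) {t : ℕ} (ht : 2 * t ≤ ℓ) :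
    10 * (ℓ : ℝ) * t / logSize k ℓ ^ 2 ≤ 1 / 2 := by
  have hL := H.one_le_log
  rw [div_le_iff₀ (by positivity)]
  have h2 : (2 * t : ℝ) ≤ ℓ := by exact_mod_cast ht
  nlinarith [H.sq_le, mul_le_mul_of_nonneg_left h2 (Nat.cast_nonneg (α := ℝ) ℓ)]

/-- For each survivor one well-populated level already supplies enough neighbours. What remains is a
union bound over the kℓ vertices. -/
theorem eventProb_not_degreesLarge_le {η : ℝ} (H : Regime k ℓ η)
    (h0 : ∀ i A v nb, 0 ≤ ρ i A v nb) (hc : ∀ i A v nb, ρ i A v nb ≤ sampleCap k ℓ i)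
    {t : ℕ} (ht : 2 * t ≤ ℓ) :
    eventProb ord (localProb ρ) t (fun R h => ¬ DegreesLarge ord R h t) ≤
      (k * ℓ * ℓ + t * ℓ + 2 * (k * ℓ)) * exp (-η) := by
  have hL := H.one_le_log
  have hk : (1 : ℝ) ≤ k := by exact_mod_cast H.one_le_k
  have hc0 : ∀ i, 0 ≤ sampleCap k ℓ i := sampleCap_nonneg (by linarith)
  have hP0 := localProb_nonneg h0
  have hP1 : ∀ G i A v, localProb ρ G i A v ≤ 1 := fun G i A v =>
    (localProb_le hc0 hc G i A v).trans (H.sampleCap_le_one i)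
  have h3 := H.three_le
  -- Level t, or t + 1 for a vertex of level t itself. Either way the level still counts as
  -- unprocessed, and the lower of the two levels is at most t, so the edge probability is at least
  -- that of level t.
  set m : HardVertex k ℓ → ℕ := fun v => if (v.1 : ℕ) = t then t + 1 else t with hm
  have hmv : ∀ v, m v ≠ v.1 ∧ t ≤ m v ∧ m v < ℓ ∧ min (v.1 : ℕ) (m v) ≤ t := by
    intro v
    simp only [hm]
    split_ifs <;> omega
  set Bad : HardVertex k ℓ → Finset (HardVertex k ℓ × HardVertex k ℓ) →
      (ℕ → Finset (HardVertex k ℓ)) → Prop := fun v R h =>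
    v ∈ alive (layeredGraph k ℓ R) ord h t ∧
      (k : ℝ) / 2 ≤ (levelPart (alive (layeredGraph k ℓ R) ord h t) (m v)).card ∧
      ((levelPart (remNbrs (layeredGraph k ℓ R) (alive (layeredGraph k ℓ R) ord h t) v)
        (m v)).card : ℝ) < 2 * (realSize k t / (32 * logSize k ℓ ^ 2)) with hBad
  have hqk : ∀ v, realSize k t / (2 * logSize k ℓ ^ 2) ≤
      crossProb k ℓ (min (v.1 : ℕ) (m v)) * (k / 2) := by
    intro v
    have h1 := mul_le_mul_of_nonneg_left (crossProb_antitone H.one_le_k ℓ (hmv v).2.2.2)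
      (by linarith : (0 : ℝ) ≤ k)
    rw [mul_crossProb H.one_le_k] at h1
    have h2 : realSize k t / (2 * logSize k ℓ ^ 2) = realSize k t / logSize k ℓ ^ 2 / 2 := by
      field_simp
    rw [h2]
    linarith
  have hbadv : ∀ v, eventProb ord (localProb ρ) t (Bad v) ≤ 2 * exp (-η) := by
    intro v
    refine (eventProb_few_survivors_le hc0 H.sampleCap_le_one h0 hc (H.half_le_prod (by omega))
      v (hmv v).1 ?_).trans ?_
    · refine le_trans (le_of_eq ?_) (hqk v)
      ring
    · refine mul_le_mul_of_nonneg_left (exp_le_exp.2 (neg_le_neg ?_)) (by norm_num)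
      have h1 := H.exponent t (by omega)
      have h2 : η ≤ realSize k t / (2 * logSize k ℓ ^ 2) / 8 := by
        rw [div_div, le_div_iff₀ (by positivity)]
        linarith
      linarith [hqk v]
  have hsub : ∀ R h, ¬ DegreesLarge ord R h t →
      (¬ LevelsSurvive ord R h t) ∨ ∃ v, Bad v R h := by
    intro R h hn
    by_cases hs : LevelsSurvive ord R h t
    · right
      unfold DegreesLarge at hn
      push Not at hn
      obtain ⟨v, hv, hlt⟩ := hn
      refine ⟨v, hv, ?_, ?_⟩
      · refine le_trans ?_ (hs (m v) (hmv v).2.1 (hmv v).2.2.1)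
        have h1 := H.ten_mul_le ht
        nlinarith
      · refine lt_of_le_of_lt (Nat.cast_le.2 (Finset.card_filter_le _ _)) (hlt.trans_eq ?_)
        ring
    · exact Or.inl hs
  refine (eventProb_mono hP0 hP1 hsub).trans ((eventProb_or_le hP0 hP1 _ _).trans ?_)
  rw [add_mul]
  refine add_le_add (eventProb_not_levelsSurvive_le H h0 hc (by omega)) ?_
  refine (eventProb_exists_le hP0 hP1 _).trans ((Finset.sum_le_sum fun v _ => hbadv v).trans
    (le_of_eq ?_))
  simp only [Finset.sum_const, Finset.card_univ, Fintype.card_prod, Fintype.card_fin, nsmul_eq_mul]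
  push_cast
  ring

end ModelBounds

/-! ### From capped rules with fixed parameters to the algorithm. -/

section Transfer

variable {k ℓ N : ℕ}

/-- The rule of `alg` when the global parameters are fixed to `σ` and the sampling probabilities
are capped. -/
noncomputable def cappedRule (alg : ReduceMIS (HardVertex k ℓ) N) {t : ℕ} (σ : Fin t → Fin N)
    (i : ℕ) (A : Finset (HardVertex k ℓ)) (v : HardVertex k ℓ) (nb : Finset (HardVertex k ℓ)) : ℝ :=
  if hi : i < t then min (alg.prob i A (σ ⟨i, hi⟩) v nb : ℝ) (sampleCap k ℓ i) else 0

/-- The sampling probabilities of `alg` as real numbers. -/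
noncomputable def algProb (alg : ReduceMIS (HardVertex k ℓ) N) (G : SimpleGraph (HardVertex k ℓ))
    (i : ℕ) (A : Finset (HardVertex k ℓ)) (v : HardVertex k ℓ) : ℝ :=
  alg.sampleProb i G A v

theorem algProb_nonneg (alg : ReduceMIS (HardVertex k ℓ) N) (G : SimpleGraph (HardVertex k ℓ))
    (i : ℕ) (A : Finset (HardVertex k ℓ)) (v : HardVertex k ℓ) : 0 ≤ algProb alg G i A v :=
  (alg.sampleProb i G A v).2.1

theorem algProb_le_one (alg : ReduceMIS (HardVertex k ℓ) N) (G : SimpleGraph (HardVertex k ℓ))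
    (i : ℕ) (A : Finset (HardVertex k ℓ)) (v : HardVertex k ℓ) : algProb alg G i A v ≤ 1 :=
  (alg.sampleProb i G A v).2.2

theorem cappedRule_nonneg {η : ℝ} (H : Regime k ℓ η) (alg : ReduceMIS (HardVertex k ℓ) N) {t : ℕ}
    (σ : Fin t → Fin N) (i : ℕ) (A : Finset (HardVertex k ℓ)) (v : HardVertex k ℓ)
    (nb : Finset (HardVertex k ℓ)) : 0 ≤ cappedRule alg σ i A v nb := by
  unfold cappedRule
  split_ifs
  · exact le_min (alg.prob _ _ _ _ _).2.1 (sampleCap_nonneg (by linarith [H.one_le_log]) i)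
  · exact le_rfl

theorem cappedRule_le {η : ℝ} (H : Regime k ℓ η) (alg : ReduceMIS (HardVertex k ℓ) N) {t : ℕ}
    (σ : Fin t → Fin N) (i : ℕ) (A : Finset (HardVertex k ℓ)) (v : HardVertex k ℓ)
    (nb : Finset (HardVertex k ℓ)) : cappedRule alg σ i A v nb ≤ sampleCap k ℓ i := by
  unfold cappedRule
  split_ifs
  · exact min_le_right _ _
  · exact sampleCap_nonneg (by linarith [H.one_le_log]) i

/-- Large degrees force small sampling probabilities. -/
theorem prob_le_sampleCap {η : ℝ} (H : Regime k ℓ η) (alg : ReduceMIS (HardVertex k ℓ) N)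
    {R : Finset (HardVertex k ℓ × HardVertex k ℓ)} {h : ℕ → Finset (HardVertex k ℓ)} {i : ℕ}
    (hi : i < ℓ) (hdeg : DegreesLarge alg.order R h i) {v : HardVertex k ℓ}
    (hv : v ∈ alive (layeredGraph k ℓ R) alg.order h i) :
    (alg.prob i (alive (layeredGraph k ℓ R) alg.order h i)
      (alg.stat i (alive (layeredGraph k ℓ R) alg.order h i) (layeredGraph k ℓ R)) v
      (remNbrs (layeredGraph k ℓ R) (alive (layeredGraph k ℓ R) alg.order h i) v) : ℝ) ≤
      sampleCap k ℓ i := by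
  have hL := H.one_le_log
  set A := alive (layeredGraph k ℓ R) alg.order h i with hA
  have hle := alg.prob_le i (layeredGraph k ℓ R) A v hv
  set p := (alg.prob i A (alg.stat i A (layeredGraph k ℓ R)) v
    (remNbrs (layeredGraph k ℓ R) A v)) with hp
  have hs : 0 < √(realSize k i) := sqrt_pos.2 (by linarith [one_le_realSize H.one_le_k i])
  have hmin : realSize k i / (16 * logSize k ℓ ^ 2) ≤ remMinDegree (layeredGraph k ℓ R) A := by
    refine (Nat.le_ceil _).trans (Nat.cast_le.2 (le_remMinDegree ⟨v, hv⟩ fun w hw => ?_))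
    exact Nat.ceil_le.2 (hdeg w hw)
  have hsq : √(realSize k i) / (4 * logSize k ℓ) ≤ √(remMinDegree (layeredGraph k ℓ R) A : ℝ) := by
    refine le_sqrt_of_sq_le (le_trans (le_of_eq ?_) hmin)
    rw [div_pow, sq_sqrt (by linarith [one_le_realSize H.one_le_k i])]
    ring
  have h1 := (mul_le_mul_of_nonneg_left hsq p.2.1).trans hle
  rw [sampleCap, if_pos hi, le_div_iff₀ hs]
  rw [mul_div_assoc', div_le_one (by positivity)] at h1
  exact h1

/-- While degrees are large the cap is inactive, so truncation changes nothing once σ is the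
sequence of parameter values that the run really produces. -/
theorem sampleWeight_alg_eq {η : ℝ} (H : Regime k ℓ η) (alg : ReduceMIS (HardVertex k ℓ) N)
    {R : Finset (HardVertex k ℓ × HardVertex k ℓ)} {h : ℕ → Finset (HardVertex k ℓ)} {t : ℕ}
    (ht : t ≤ ℓ) (hdeg : ∀ i < t, DegreesLarge alg.order R h i) :
    sampleWeight (layeredGraph k ℓ R) alg.order (algProb alg (layeredGraph k ℓ R)) h t =
      sampleWeight (layeredGraph k ℓ R) alg.order
        (localProb (cappedRule alg fun i : Fin t => alg.stat i
          (alive (layeredGraph k ℓ R) alg.order h i) (layeredGraph k ℓ R))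
          (layeredGraph k ℓ R)) h t := by
  refine Finset.prod_congr rfl fun i hi => ?_
  have hi := Finset.mem_range.1 hi
  congr 1
  funext v
  unfold algProb ReduceMIS.sampleProb localProb cappedRule
  split_ifs with hv
  · exact (min_eq_left (prob_le_sampleCap H alg (by omega) (hdeg i hi) hv)).symm
  · rfl

/-- As long as the degrees stay large, an event is at most as likely as under the capped rules,
up to a union bound over the global parameters. -/
theorem eventProb_alg_le {η : ℝ} (H : Regime k ℓ η) (alg : ReduceMIS (HardVertex k ℓ) N)
    {t : ℕ} (ht : t ≤ ℓ) {ε : ℝ}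
    (Z : Finset (HardVertex k ℓ × HardVertex k ℓ) → (ℕ → Finset (HardVertex k ℓ)) → Prop)
    (hZ : ∀ σ : Fin t → Fin N, eventProb alg.order (localProb (cappedRule alg σ)) t Z ≤ ε) :
    eventProb alg.order (algProb alg) t
      (fun R h => (∀ i < t, DegreesLarge alg.order R h i) ∧ Z R h) ≤ N ^ t * ε := by
  have hn : ∀ (σ : Fin t → Fin N) G h, 0 ≤ sampleWeight G alg.order
      (localProb (cappedRule alg σ) G) h t := fun σ G h =>
    sampleWeight_nonneg (localProb_nonneg (cappedRule_nonneg H alg σ) G) (fun i A v =>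
      (localProb_le (sampleCap_nonneg (by linarith [H.one_le_log])) (cappedRule_le H alg σ)
        G i A v).trans (H.sampleCap_le_one i)) h t
  calc _ ≤ ∑ σ : Fin t → Fin N, eventProb alg.order (localProb (cappedRule alg σ)) t Z := by
        unfold eventProb
        rw [Finset.sum_comm]
        refine Finset.sum_le_sum fun R _ => ?_
        rw [← Finset.mul_sum, ← pathSum_sum]
        refine mul_le_mul_of_nonneg_left (pathSum_mono t fun h => ?_) (edgeWeight_nonneg R)
        have hterm : ∀ σ : Fin t → Fin N, 0 ≤ sampleWeight (layeredGraph k ℓ R) alg.order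
            (localProb (cappedRule alg σ) (layeredGraph k ℓ R)) h t * ind (Z R h) := fun σ =>
          mul_nonneg (hn σ _ h) (ind_nonneg _)
        by_cases hg : (∀ i < t, DegreesLarge alg.order R h i) ∧ Z R h
        -- The real parameter sequence is one of the summands and the others are nonnegative.
        · rw [sampleWeight_alg_eq H alg ht hg.1, ind_of hg, ← ind_of hg.2]
          exact Finset.single_le_sum (f := fun σ : Fin t → Fin N =>
            sampleWeight (layeredGraph k ℓ R) alg.order
              (localProb (cappedRule alg σ) (layeredGraph k ℓ R)) h t * ind (Z R h))
            (fun σ _ => hterm σ) (Finset.mem_univ _)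
        · rw [ind_of_not hg, mul_zero]
          exact Finset.sum_nonneg fun σ _ => hterm σ
    _ ≤ ∑ _σ : Fin t → Fin N, ε := Finset.sum_le_sum fun σ _ => hZ σ
    _ = N ^ t * ε := by simp

theorem eventProb_succ_of_update
    {ord : ℕ → Fin (Fintype.card (HardVertex k ℓ)) ≃ HardVertex k ℓ}
    {P : SimpleGraph (HardVertex k ℓ) → ℕ → Finset (HardVertex k ℓ) → HardVertex k ℓ → ℝ} {t : ℕ}
    {Z : Finset (HardVertex k ℓ × HardVertex k ℓ) → (ℕ → Finset (HardVertex k ℓ)) → Prop}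
    (hZ : ∀ R h S, Z R (Function.update h t S) ↔ Z R h) :
    eventProb ord P (t + 1) Z = eventProb ord P t Z := by
  refine Finset.sum_congr rfl fun R _ => ?_
  rw [pathSum_sampleWeight_succ_of_update _ _ _ _ _ fun h S => by rw [propext (hZ R h S)]]

theorem degreesLarge_update (ord : ℕ → Fin (Fintype.card (HardVertex k ℓ)) ≃ HardVertex k ℓ)
    (R : Finset (HardVertex k ℓ × HardVertex k ℓ)) (h : ℕ → Finset (HardVertex k ℓ))
    (S : Finset (HardVertex k ℓ)) {i t : ℕ} (hi : i ≤ t) :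
    DegreesLarge ord R (Function.update h t S) i ↔ DegreesLarge ord R h i := by
  unfold DegreesLarge
  rw [alive_update _ _ _ _ hi]

/-- A common bound for the failure probabilities under a capped rule. -/
noncomputable def modelError (k ℓ : ℕ) (η : ℝ) : ℝ := 4 * (k * ℓ : ℝ) ^ 2 * exp (-η)

theorem Regime.error_le {η : ℝ} (H : Regime k ℓ η) {t : ℕ} (ht : t ≤ ℓ) :
    (k * ℓ * ℓ + t * ℓ + 2 * (k * ℓ)) * exp (-η) ≤ modelError k ℓ η := by
  refine mul_le_mul_of_nonneg_right ?_ (exp_pos _).le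
  have hk : (1 : ℝ) ≤ k := by exact_mod_cast H.one_le_k
  have hℓ : (3 : ℝ) ≤ ℓ := by exact_mod_cast H.three_le
  have ht' : (t : ℝ) ≤ ℓ := by exact_mod_cast ht
  have h1 : (ℓ : ℝ) ≤ k * ℓ := by nlinarith
  have h2 : (k * ℓ : ℝ) * ℓ ≤ (k * ℓ) * (k * ℓ) := mul_le_mul_of_nonneg_left h1 (by positivity)
  have h3 : (t * ℓ : ℝ) ≤ (k * ℓ) * (k * ℓ) :=
    mul_le_mul (ht'.trans h1) h1 (by positivity) (by positivity)
  have h4 : (k * ℓ : ℝ) * 1 ≤ (k * ℓ) * (k * ℓ) :=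
    mul_le_mul_of_nonneg_left (by linarith) (by positivity)
  nlinarith

/-- Split by the first iteration with a small degree: before it the algorithm obeys the cap, so the
estimate for capped rules applies. -/
theorem eventProb_alg_exists_not_degreesLarge_le {η : ℝ} (H : Regime k ℓ η) (hN : 1 ≤ N)
    (alg : ReduceMIS (HardVertex k ℓ) N) {t : ℕ} (ht : 2 * t ≤ ℓ) :
    eventProb alg.order (algProb alg) t (fun R h => ∃ i < t, ¬ DegreesLarge alg.order R h i) ≤
      t * (N ^ ℓ * modelError k ℓ η) := by
  have hN' : (1 : ℝ) ≤ N := by exact_mod_cast hN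
  have herr : 0 ≤ modelError k ℓ η := by unfold modelError; positivity
  induction t with
  | zero =>
    have h0 : ind False = 0 := ind_of_not id
    simp [eventProb, pathSum, h0]
  | succ t ih =>
    -- Degrees up to time t depend only on the samples before t, so sample t is summed out.
    rw [eventProb_succ_of_update (fun R h S => exists_congr fun i => and_congr_right fun hi =>
      not_congr (degreesLarge_update _ R h S (by omega)))]
    have hstep : eventProb alg.order (algProb alg) t
        (fun R h => (∀ i < t, DegreesLarge alg.order R h i) ∧ ¬ DegreesLarge alg.order R h t) ≤
        N ^ t * modelError k ℓ η :=
      eventProb_alg_le H alg (by omega) _ fun σ =>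
        (eventProb_not_degreesLarge_le H (cappedRule_nonneg H alg σ) (cappedRule_le H alg σ)
          (by omega)).trans (H.error_le (by omega))
    have hpow : (N : ℝ) ^ t ≤ N ^ ℓ := pow_le_pow_right₀ hN' (by omega)
    have hsub : ∀ R h, (∃ i < t + 1, ¬ DegreesLarge alg.order R h i) →
        (∃ i < t, ¬ DegreesLarge alg.order R h i) ∨
        ((∀ i < t, DegreesLarge alg.order R h i) ∧ ¬ DegreesLarge alg.order R h t) := by
      rintro R h ⟨i, hi, hn⟩
      by_cases hex : ∃ i < t, ¬ DegreesLarge alg.order R h i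
      · exact Or.inl hex
      · push Not at hex
        rcases Nat.lt_succ_iff_lt_or_eq.1 hi with hlt | rfl
        · exact absurd (hex i hlt) hn
        · exact Or.inr ⟨hex, hn⟩
    refine (eventProb_mono (algProb_nonneg alg) (algProb_le_one alg) hsub).trans
      ((eventProb_or_le (algProb_nonneg alg) (algProb_le_one alg) _ _).trans ?_)
    push_cast
    rw [add_mul, one_mul]
    exact add_le_add (ih (by omega))
      (hstep.trans (mul_le_mul_of_nonneg_right hpow herr))

theorem eventProb_alg_not_levelsSurvive_le {η : ℝ} (H : Regime k ℓ η) (hN : 1 ≤ N)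
    (alg : ReduceMIS (HardVertex k ℓ) N) {t : ℕ} (ht : 2 * t ≤ ℓ) :
    eventProb alg.order (algProb alg) t (fun R h => ¬ LevelsSurvive alg.order R h t) ≤
      ℓ * (N ^ ℓ * modelError k ℓ η) := by
  have hN' : (1 : ℝ) ≤ N := by exact_mod_cast hN
  have herr : 0 ≤ modelError k ℓ η := by unfold modelError; positivity
  have h1 := eventProb_alg_exists_not_degreesLarge_le H hN alg ht
  have h2 : eventProb alg.order (algProb alg) t
      (fun R h => (∀ i < t, DegreesLarge alg.order R h i) ∧ ¬ LevelsSurvive alg.order R h t) ≤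
      N ^ t * modelError k ℓ η :=
    eventProb_alg_le H alg (by omega) _ fun σ => by
      refine ((eventProb_not_levelsSurvive_le H (cappedRule_nonneg H alg σ)
        (cappedRule_le H alg σ) (by omega)).trans ?_).trans (H.error_le (t := t) (by omega))
      refine mul_le_mul_of_nonneg_right ?_ (exp_pos _).le
      have : (0 : ℝ) ≤ 2 * (k * ℓ) := by positivity
      linarith
  have hpow : (N : ℝ) ^ t ≤ N ^ ℓ := pow_le_pow_right₀ hN' (by omega)
  have h3 : (t : ℝ) + 1 ≤ ℓ := by
    have := H.three_le
    exact_mod_cast (by omega : t + 1 ≤ ℓ)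
  have hX : 0 ≤ (N : ℝ) ^ ℓ * modelError k ℓ η := by positivity
  have hsub : ∀ R h, ¬ LevelsSurvive alg.order R h t →
      (∃ i < t, ¬ DegreesLarge alg.order R h i) ∨
      ((∀ i < t, DegreesLarge alg.order R h i) ∧ ¬ LevelsSurvive alg.order R h t) := by
    intro R h hn
    by_cases hex : ∃ i < t, ¬ DegreesLarge alg.order R h i
    · exact Or.inl hex
    · push Not at hex
      exact Or.inr ⟨hex, hn⟩
  refine (eventProb_mono (algProb_nonneg alg) (algProb_le_one alg) hsub).trans
    ((eventProb_or_le (algProb_nonneg alg) (algProb_le_one alg) _ _).trans ?_)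
  have h4 := mul_le_mul_of_nonneg_right hpow herr
  nlinarith [mul_le_mul_of_nonneg_right h3 hX]

theorem hardActive_toReal (alg : ReduceMIS (HardVertex k ℓ) N) (t : ℕ)
    (E : Set (Finset (HardVertex k ℓ))) :
    ((hardActive alg t).toOuterMeasure E).toReal = eventProb alg.order (algProb alg) t
      fun R h => alive (layeredGraph k ℓ R) alg.order h t ∈ E := by
  rw [PMF.toReal_toOuterMeasure, mean_hardActive]
  rfl

theorem one_sub_eventProb_not {ord : ℕ → Fin (Fintype.card (HardVertex k ℓ)) ≃ HardVertex k ℓ}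
    {P : SimpleGraph (HardVertex k ℓ) → ℕ → Finset (HardVertex k ℓ) → HardVertex k ℓ → ℝ} {t : ℕ}
    (Z : Finset (HardVertex k ℓ × HardVertex k ℓ) → (ℕ → Finset (HardVertex k ℓ)) → Prop) :
    1 - eventProb ord P t (fun R h => ¬ Z R h) = eventProb ord P t Z := by
  rw [sub_eq_iff_eq_add]
  unfold eventProb
  rw [← Finset.sum_add_distrib, ← sum_edgeWeight]
  refine Finset.sum_congr rfl fun R _ => ?_
  rw [← mul_add, ← pathSum_add, ← mul_one (edgeWeight R), mul_assoc]
  congr 1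
  rw [one_mul, ← pathSum_sampleWeight (layeredGraph k ℓ R) ord (P (layeredGraph k ℓ R)) t]
  congr 1
  funext h
  by_cases hZ : Z R h
  · rw [ind_of hZ, ind_of_not (not_not.2 hZ)]
    ring
  · rw [ind_of_not hZ, ind_of hZ]
    ring

theorem le_hardActive_of_levelsSurvive {η : ℝ} (H : Regime k ℓ η)
    (alg : ReduceMIS (HardVertex k ℓ) N) {t : ℕ} (ht : 2 * t ≤ ℓ)
    (E : Set (Finset (HardVertex k ℓ)))
    (hE : ∀ A : Finset (HardVertex k ℓ), (∀ j, t ≤ j → j < ℓ →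
      (k : ℝ) * (1 - 10 * ℓ * t / logSize k ℓ ^ 2) ≤ (levelPart A j).card) → A ∈ E) :
    1 - ℓ * (N ^ ℓ * modelError k ℓ η) ≤ ((hardActive alg t).toOuterMeasure E).toReal := by
  have hℓ := H.three_le
  have hk := H.one_le_k
  -- The parameter function itself exhibits an element of `Fin N`.
  have hN : 1 ≤ N := by
    have x : Fin N := alg.stat 0 ∅ ⊥
    exact x.pos
  rw [hardActive_toReal]
  have h1 := eventProb_alg_not_levelsSurvive_le H hN alg ht
  have h2 := one_sub_eventProb_not (ord := alg.order) (P := algProb alg) (t := t)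
    (fun R h => LevelsSurvive alg.order R h t)
  have h3 : eventProb alg.order (algProb alg) t (fun R h => LevelsSurvive alg.order R h t) ≤
      eventProb alg.order (algProb alg) t
        (fun R h => alive (layeredGraph k ℓ R) alg.order h t ∈ E) :=
    eventProb_mono (algProb_nonneg alg) (algProb_le_one alg) fun R h hs => hE _ hs
  linarith

end Transfer

/-! ### The parameter regime for large k. -/

section Asymptotics

theorem eventually_pow_le_two_rpow (n : ℕ) :
    ∀ᶠ x : ℝ in Filter.atTop, 512 * x ^ n ≤ (2 : ℝ) ^ x := by
  have h := isLittleO_pow_exp_pos_mul_atTop n (Real.log_pos one_lt_two)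
  filter_upwards [h.bound (by norm_num : (0 : ℝ) < 1 / 512), Filter.eventually_ge_atTop 0]
    with x hx hx0
  rw [norm_of_nonneg (by positivity), norm_of_nonneg (exp_pos _).le] at hx
  rw [rpow_def_of_pos (by norm_num)]
  linarith

theorem tendsto_sqrt_logb_two :
    Filter.Tendsto (fun k : ℕ => √(logb 2 (k : ℝ))) Filter.atTop Filter.atTop :=
  tendsto_sqrt_atTop.comp ((tendsto_logb_atTop one_lt_two).comp tendsto_natCast_atTop_atTop)

/-- The conditions on `k`, in terms of `x = √(log k)`, under which the parameters behave as
expected. -/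
structure LargeParams (k ℓ : ℕ) (x : ℝ) : Prop where
  large : (2 : ℝ) ^ 30 ≤ x
  growth : 512 * x ^ 10 ≤ (2 : ℝ) ^ x
  log_eq : logb 2 (k : ℝ) = x ^ 2
  levels : ℓ = ⌊logb 2 (x ^ 2) / 20⌋₊

namespace LargeParams

variable {k ℓ : ℕ} {x : ℝ}

theorem k_eq (P : LargeParams k ℓ x) : (k : ℝ) = 2 ^ (x ^ 2) := by
  have hk : (k : ℝ) ≠ 0 := by
    intro h0
    have h1 := P.log_eq
    have h2 := P.large
    rw [h0, logb_zero] at h1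
    nlinarith
  rw [← P.log_eq, rpow_logb (by norm_num) (by norm_num) (by positivity)]

theorem sixty_le (P : LargeParams k ℓ x) : 60 ≤ logb 2 (x ^ 2) := by
  have h := P.large
  have hx : 0 < x := lt_of_lt_of_le (by positivity) h
  rw [le_logb_iff_rpow_le (by norm_num) (by positivity)]
  calc (2 : ℝ) ^ (60 : ℝ) = (2 ^ 30) ^ 2 := by
        rw [← pow_mul]
        exact_mod_cast rfl
    _ ≤ x ^ 2 := pow_le_pow_left₀ (by positivity) h 2

theorem levels_le (P : LargeParams k ℓ x) : (ℓ : ℝ) ≤ logb 2 (x ^ 2) / 20 := by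
  rw [P.levels]
  exact Nat.floor_le (by linarith [P.sixty_le])

theorem lt_levels (P : LargeParams k ℓ x) : logb 2 (x ^ 2) / 20 - 1 < ℓ := by
  rw [P.levels]
  linarith [Nat.lt_floor_add_one (logb 2 (x ^ 2) / 20)]

theorem three_le_levels (P : LargeParams k ℓ x) : 3 ≤ ℓ := by
  rw [P.levels]
  exact Nat.le_floor (by push_cast; linarith [P.sixty_le])

theorem logb_le (P : LargeParams k ℓ x) : logb 2 (x ^ 2) ≤ x ^ 2 := by
  have h := P.large
  have hx : 0 < x := lt_of_lt_of_le (by positivity) h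
  rw [logb_le_iff_le_rpow (by norm_num) (by positivity), ← P.k_eq]
  have h1 : (k : ℝ) = 2 ^ (x ^ 2) := P.k_eq
  rw [h1]
  have h2 : x ≤ x ^ 2 := by nlinarith
  have h3 : (2 : ℝ) ^ x ≤ 2 ^ (x ^ 2) := rpow_le_rpow_of_exponent_le (by norm_num) h2
  have h4 : x ^ 2 ≤ x ^ 10 := pow_le_pow_right₀ (by linarith) (by norm_num)
  nlinarith [P.growth, pow_pos hx 10]

theorem levels_le_sq (P : LargeParams k ℓ x) : (ℓ : ℝ) ≤ x ^ 2 / 20 := by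
  linarith [P.levels_le, P.logb_le]

theorem logSize_mem (P : LargeParams k ℓ x) :
    x ^ 2 ≤ logSize k ℓ ∧ logSize k ℓ ≤ x ^ 2 + logb 2 (x ^ 2) := by
  have hℓ : (3 : ℝ) ≤ ℓ := by exact_mod_cast P.three_le_levels
  have hk : (0 : ℝ) < k := by rw [P.k_eq]; positivity
  have hx : 0 < x := lt_of_lt_of_le (by positivity) P.large
  unfold logSize
  rw [logb_mul hk.ne' (by positivity), P.log_eq]
  constructor
  · linarith [logb_nonneg one_lt_two (by linarith : (1 : ℝ) ≤ ℓ)]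
  · have := logb_le_logb_of_le one_lt_two (by linarith : (0 : ℝ) < ℓ)
      (P.levels_le_sq.trans (by linarith [sq_nonneg x] : x ^ 2 / 20 ≤ x ^ 2))
    linarith

theorem logSize_le (P : LargeParams k ℓ x) : logSize k ℓ ≤ 2 * x ^ 2 := by
  linarith [P.logSize_mem.2, P.logb_le]

/-- With x = √(log k), i < ℓ ≤ log log k/20 gives 4^i ≤ √x, so the exponent x²/4^i is at least x√x ≥
3x. -/
theorem le_realSize (P : LargeParams k ℓ x) {i : ℕ} (hi : i < ℓ) :
    (2 : ℝ) ^ (3 * x) ≤ realSize k i := by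
  have hlarge := P.large
  have hx : 0 < x := lt_of_lt_of_le (by positivity) hlarge
  unfold realSize
  rw [P.k_eq, ← rpow_mul (by norm_num)]
  refine rpow_le_rpow_of_exponent_le (by norm_num) ?_
  rw [mul_one_div, le_div_iff₀ (by positivity)]
  have h1 : (4 : ℝ) ^ i ≤ √x := by
    have h2 : (4 : ℝ) ^ i = 2 ^ (2 * i : ℝ) := by
      rw [rpow_mul (by norm_num), rpow_natCast]
      norm_num
    have h3 : √x = 2 ^ (logb 2 (x ^ 2) / 4) := by
      rw [sqrt_eq_rpow]
      have : logb 2 (x ^ 2) = 2 * logb 2 x := by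
        rw [logb_pow]
        norm_num
      rw [this, show 2 * logb 2 x / 4 = logb 2 x * (1 / 2) by ring, rpow_mul (by norm_num),
        rpow_logb (by norm_num) (by norm_num) hx]
    rw [h2, h3]
    refine rpow_le_rpow_of_exponent_le (by norm_num) ?_
    have h4 : (i : ℝ) ≤ ℓ := by exact_mod_cast hi.le
    linarith [P.levels_le, P.sixty_le]
  have h5 : 3 ≤ √x := le_sqrt_of_sq_le (by linarith)
  have h6 : √x * √x = x := mul_self_sqrt hx.le
  nlinarith [mul_le_mul_of_nonneg_left h1 hx.le, mul_le_mul_of_nonneg_left h5 (sqrt_nonneg x)]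

theorem regime (P : LargeParams k ℓ x) : Regime k ℓ (2 ^ (2 * x)) := by
  have hlarge := P.large
  have hx : 0 < x := lt_of_lt_of_le (by positivity) hlarge
  have hx1 : 1 ≤ x := by linarith
  obtain ⟨hL1, -⟩ := P.logSize_mem
  have hL2 := P.logSize_le
  have hℓ := P.levels_le_sq
  have hL0 : 0 ≤ logSize k ℓ := (sq_nonneg x).trans hL1
  have hk1 : (1 : ℝ) ≤ k := by
    rw [P.k_eq]
    exact one_le_rpow (by norm_num) (sq_nonneg x)
  have h2x : (1 : ℝ) ≤ 2 ^ x := one_le_rpow (by norm_num) hx.le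
  refine ⟨by exact_mod_cast hk1, P.three_le_levels, ?_, ?_, fun i hi => ?_, fun i hi => ?_, ?_,
    by positivity⟩
  · nlinarith
  · have h1 : (ℓ : ℝ) ^ 2 ≤ (x ^ 2 / 20) ^ 2 := pow_le_pow_left₀ (by positivity) hℓ 2
    have h2 : (x ^ 2) ^ 2 ≤ logSize k ℓ ^ 2 := pow_le_pow_left₀ (by positivity) hL1 2
    nlinarith
  · refine le_trans ?_ (P.le_realSize hi)
    have h1 : (ℓ : ℝ) ^ 2 ≤ (x ^ 2) ^ 2 :=
      pow_le_pow_left₀ (by positivity) (hℓ.trans (by linarith [sq_nonneg x])) 2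
    have h2 : logSize k ℓ ^ 3 ≤ (2 * x ^ 2) ^ 3 := pow_le_pow_left₀ hL0 hL2 3
    calc 64 * (ℓ : ℝ) ^ 2 * logSize k ℓ ^ 3 ≤ 64 * (x ^ 2) ^ 2 * (2 * x ^ 2) ^ 3 :=
          mul_le_mul (by linarith) h2 (by positivity) (by positivity)
      _ = 512 * x ^ 10 := by ring
      _ ≤ 2 ^ x := P.growth
      _ ≤ 2 ^ (3 * x) := rpow_le_rpow_of_exponent_le (by norm_num) (by linarith)
  · refine le_trans ?_ (P.le_realSize hi)
    have h2 : logSize k ℓ ^ 2 ≤ (2 * x ^ 2) ^ 2 := pow_le_pow_left₀ hL0 hL2 2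
    have h3 : x ^ 4 ≤ x ^ 10 := pow_le_pow_right₀ hx1 (by norm_num)
    have h4 : 16 * logSize k ℓ ^ 2 ≤ 2 ^ x := by
      nlinarith [P.growth, pow_pos hx 10]
    -- Of s_i ≥ 2^(3x), a factor 2^x pays for the polylogarithmic terms and 2^(2x) is the exponent
    -- η.
    rw [show 3 * x = x + 2 * x by ring, rpow_add (by norm_num)]
    exact mul_le_mul_of_nonneg_right h4 (by positivity)
  · rw [P.k_eq, sqrt_eq_rpow, ← rpow_mul (by norm_num)]
    refine rpow_le_rpow_of_exponent_le (by norm_num) ?_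
    nlinarith

/-- The total failure probability is doubly exponentially small. -/
theorem error_le (P : LargeParams k ℓ x) {C N : ℕ}
    (hC : 512 * x ^ (3 * C + 2) ≤ (2 : ℝ) ^ x)
    (hN : (N : ℝ) ≤ (2 : ℝ) ^ (logSize k ℓ ^ C)) :
    ℓ * (N ^ ℓ * modelError k ℓ (2 ^ (2 * x))) ≤ (2 : ℝ) ^ (-(2 : ℝ) ^ √(logSize k ℓ)) := by
  have hlarge := P.large
  have hx : 0 < x := lt_of_lt_of_le (by positivity) hlarge
  have hx2 : 2 ≤ x := by linarith
  obtain ⟨hL1, -⟩ := P.logSize_mem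
  have hL2 := P.logSize_le
  have hL0 : 0 ≤ logSize k ℓ := (sq_nonneg x).trans hL1
  have hℓ : (3 : ℝ) ≤ ℓ := by exact_mod_cast P.three_le_levels
  have hℓx : (ℓ : ℝ) ≤ x ^ 2 := P.levels_le_sq.trans (by linarith [sq_nonneg x])
  have hk : (1 : ℝ) ≤ k := by exact_mod_cast P.regime.one_le_k
  set L := logSize k ℓ with hL
  have hkl : (k * ℓ : ℝ) = 2 ^ L := by
    rw [hL, logSize, rpow_logb (by norm_num) (by norm_num) (by positivity)]
  have hℓL : (ℓ : ℝ) ≤ 2 ^ L := by rw [← hkl]; nlinarith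
  have hNpow : (N : ℝ) ^ ℓ ≤ 2 ^ (L ^ C * ℓ) := by
    rw [rpow_mul_natCast (by norm_num)]
    exact pow_le_pow_left₀ (by positivity) hN ℓ
  have hexp : exp (-(2 : ℝ) ^ (2 * x)) ≤ 2 ^ (-(2 : ℝ) ^ (2 * x)) := by
    have h1 : (0 : ℝ) < 2 ^ (2 * x) := by positivity
    rw [rpow_def_of_pos (by norm_num) (-(2 : ℝ) ^ (2 * x)), exp_le_exp]
    nlinarith [Real.log_two_lt_d9]
  have herr : modelError k ℓ (2 ^ (2 * x)) ≤ 2 ^ (2 + 2 * L + -(2 : ℝ) ^ (2 * x)) := by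
    unfold modelError
    rw [hkl, rpow_add (by norm_num), rpow_add (by norm_num), mul_comm 2 L,
      rpow_mul (by norm_num) L 2, rpow_two, rpow_two]
    norm_num only
    exact mul_le_mul_of_nonneg_left hexp (by positivity)
  have hm0 : 0 ≤ modelError k ℓ (2 ^ (2 * x)) := by unfold modelError; positivity
  calc (ℓ : ℝ) * (N ^ ℓ * modelError k ℓ (2 ^ (2 * x)))
      ≤ 2 ^ L * (2 ^ (L ^ C * ℓ) * 2 ^ (2 + 2 * L + -(2 : ℝ) ^ (2 * x))) :=
        mul_le_mul hℓL (mul_le_mul hNpow herr hm0 (by positivity)) (by positivity) (by positivity)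
    _ = 2 ^ (L + (L ^ C * ℓ + (2 + 2 * L + -(2 : ℝ) ^ (2 * x)))) := by
        rw [rpow_add (by norm_num) L, rpow_add (by norm_num) (L ^ C * ℓ)]
    _ ≤ 2 ^ (-(2 : ℝ) ^ √L) := by
        refine rpow_le_rpow_of_exponent_le (by norm_num) ?_
        -- L ≤ 2x² puts √L below 3x/2, strictly under the 2x in η; this gap absorbs every other term
        -- of the exponent.
        have h1 : √L ≤ 3 / 2 * x := by
          refine sqrt_le_iff.2 ⟨by positivity, ?_⟩
          nlinarith
        have h2 : (2 : ℝ) ^ √L ≤ 2 ^ (3 / 2 * x) :=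
          rpow_le_rpow_of_exponent_le (by norm_num) h1
        have h3 : (2 : ℝ) ^ x ≤ 2 ^ (3 / 2 * x) :=
          rpow_le_rpow_of_exponent_le (by norm_num) (by linarith)
        have h4 : 2 * (2 : ℝ) ^ (3 / 2 * x) ≤ 2 ^ (2 * x) := by
          rw [show 2 * x = x / 2 + 3 / 2 * x by ring, rpow_add (by norm_num)]
          refine mul_le_mul_of_nonneg_right ?_ (by positivity)
          calc (2 : ℝ) = 2 ^ (1 : ℝ) := (rpow_one 2).symm
            _ ≤ 2 ^ (x / 2) := rpow_le_rpow_of_exponent_le (by norm_num) (by linarith)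
        -- The cost of the union bound over parameters: L ≤ 2x² ≤ x³ and ℓ ≤ x², so the growth
        -- condition makes it at most 2^x/512.
        have h5 : L ^ C * ℓ ≤ x ^ (3 * C + 2) := by
          rw [pow_add, pow_mul]
          refine mul_le_mul (pow_le_pow_left₀ hL0 ?_ C) hℓx (by positivity) (by positivity)
          nlinarith [sq_nonneg x]
        have h6 : x ^ 2 ≤ x ^ (3 * C + 2) := pow_le_pow_right₀ (by linarith) (by omega)
        nlinarith
end LargeParams

end Asymptotics

/-! ### The main theorem. -/

theorem mainTheorem5 :
    ∃ c : ℝ, 0 < c ∧ ∀ C : ℕ, ∃ k₀ : ℕ, ∀ k ℓ N : ℕ, k₀ ≤ k →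
      ℓ = ⌊Real.logb 2 (Real.logb 2 (k : ℝ)) / 20⌋₊ →
      (N : ℝ) ≤ (2 : ℝ) ^ (Real.logb 2 ((k : ℝ) * ℓ) ^ C) →
      ∀ alg : ReduceMIS (HardVertex k ℓ) N,
        (∀ t : ℕ, (t : ℝ) < c * Real.logb 2 (Real.logb 2 ((k : ℝ) * ℓ)) →
          1 - (2 : ℝ) ^ (-(2 : ℝ) ^ (√(Real.logb 2 ((k : ℝ) * ℓ)))) ≤
            ((hardActive alg t).toOuterMeasure {A | A.Nonempty}).toReal) ∧
        (∀ r j : ℕ, 2 * r ≤ ℓ → r ≤ j → j < ℓ →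
          1 - (2 : ℝ) ^ (-(2 : ℝ) ^ (√(Real.logb 2 ((k : ℝ) * ℓ)))) ≤
            ((hardActive alg r).toOuterMeasure
              {A | (k : ℝ) * (1 - 10 * ℓ * r / Real.logb 2 ((k : ℝ) * ℓ) ^ 2) ≤
                ((A.filter fun v => (v.1 : ℕ) = j).card : ℝ)}).toReal) := by
  -- With y = log log k ≥ 60 and log log n ≤ 1 + y, the constant 1/100 gives 2t < (1 + y)/50 ≤ y/20
  -- - 1 < ℓ.
  refine ⟨1 / 100, by norm_num, fun C => ?_⟩
  have hev := tendsto_sqrt_logb_two.eventually ((Filter.eventually_ge_atTop ((2 : ℝ) ^ 30)).and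
    ((eventually_pow_le_two_rpow 10).and (eventually_pow_le_two_rpow (3 * C + 2))))
  obtain ⟨k₀, hk₀⟩ := Filter.eventually_atTop.1 hev
  refine ⟨k₀, fun k ℓ N hk hℓ hN alg => ?_⟩
  obtain ⟨hx1, hx2, hx3⟩ := hk₀ k hk
  set x := √(logb 2 (k : ℝ)) with hx
  have hx0 : 0 < x := lt_of_lt_of_le (by positivity) hx1
  have hlog : logb 2 (k : ℝ) = x ^ 2 := (sq_sqrt (sqrt_pos.1 hx0).le).symm
  have P : LargeParams k ℓ x := ⟨hx1, hx2, hlog, by rw [hℓ, hlog]⟩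
  have H := P.regime
  have herr := P.error_le hx3 hN
  change _ ≤ (2 : ℝ) ^ (-(2 : ℝ) ^ √(logb 2 ((k : ℝ) * ℓ))) at herr
  refine ⟨fun t ht => ?_, fun r j hr hrj hj => ?_⟩
  · have ht2 : 2 * t ≤ ℓ := by
      have h1 : logb 2 (logSize k ℓ) ≤ 1 + logb 2 (x ^ 2) := by
        have h2 := logb_le_logb_of_le one_lt_two
          (lt_of_lt_of_le (by positivity) P.logSize_mem.1) P.logSize_le
        rwa [logb_mul (by norm_num) (by positivity), logb_self_eq_one one_lt_two] at h2
      change (t : ℝ) < 1 / 100 * logb 2 (logSize k ℓ) at ht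
      have h3 : (2 * t : ℝ) ≤ ℓ := by linarith [P.lt_levels, P.sixty_le]
      exact_mod_cast h3
    refine le_trans (by linarith) (le_hardActive_of_levelsSurvive H alg ht2 _ fun A hA => ?_)
    -- Level t alone shows that the graph is nonempty: it keeps at least k/2 vertices.
    have h1 := hA t le_rfl (by have := H.three_le; omega)
    have h2 := H.ten_mul_le ht2
    have hk1 : (1 : ℝ) ≤ k := by exact_mod_cast H.one_le_k
    have h3 : (0 : ℝ) < (levelPart A t).card := lt_of_lt_of_le (by nlinarith) h1
    exact (Finset.card_pos.1 (by exact_mod_cast h3)).mono (Finset.filter_subset _ _)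
  · exact le_trans (by linarith) (le_hardActive_of_levelsSurvive H alg hr _ fun A hA => hA j hrj hj)
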